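/- **Setting.** Let $H$ be a separable real Hilbert space and let $(e_k)_{k\in\mathbb N}$ be a fixed sequence in $H$ whose linear span is dense (for instance an orthonormal basis). Let $\mathcal T=\mathfrak D([0,\infty);H)$ be the set of càglàd functions $\Phi:[0,\infty)\to H$, i.e. those which are left-continuous at every $t>0$ and have a limit from the right at every $t\ge 0$. For $M\ge 1$ let $\widehat\Phi_M:[-1,M+1]\to H$ be equal to $\Phi(0)$ on $[-1,0]$, to $\Phi$ on $(0,M)$ and to $\Phi(M)$ on $[M,M+1]$. Equip $\mathcal T$ with the metric $$d_\infty(\Phi,\Psi)=\sum_{M=1}^\infty\sum_{k=1}^\infty \frac1{2^{M}}\frac{1}{2^{k}}\,\frac{d_M(\langle\widehat\Phi_M;e_k\rangle,\langle\widehat\Psi_M;e_k\rangle)}{1+d_M(\langle\widehat\Phi_M;e_k\rangle,\langle\widehat\Psi_M;e_k\rangle)},$$ where $d_M$ is the Skorokhod $M_1$ metric for real-valued càglàd functions on $[-1,M+1]$: $d_M(f,g)$ is the infimum of $\max(\|u_1-u_2\|_\infty,\|r_1-r_2\|_\infty)$ over all parametric representations $(u_1,r_1)$ of $f$ and $(u_2,r_2)$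 of $g$, that is, continuous nondecreasing maps of $[0,1]$ onto the completed graphs of $f$ and of $g$. The completed graph of $f$ consists of the points $(z,t)$ with $z$ on the segment between $f(t)$ and $f(t+)$; it is ordered by increasing $t$ and, for equal $t$, by increasing distance of $z$ from $f(t)$. For $T>0$ and $\Phi,\Phi_1,\Phi_2\in\mathcal T$ put $S_T\Phi(t)=\Phi(T+t)$ for $t\ge0$, and let $(\Phi_1\cup_T\Phi_2)(t)$ be $\Phi_1(t)$ for $0\le t\le T$ and $\Phi_2(t-T)$ for $t>T$. **Theorem.** Let $D\subset H$ be closed and convex, and let $\mathcal U$ be a map from $D$ to the subsets of $\mathcal T$ such that every $\Phi\in\mathcal U(x)$ starts at $x$, i.e. $\Phi(0)=x$, and 1. (non-emptiness) $\mathcal U(x)\neq\emptyset$ for every $x\in D$; 2. (compactness) $\mathcal U(x)$ is a compact subset of $\mathcal T$ for every $x\in D$; 3. (measurability) $\mathcal U$ is Borel measurable: $\{x\in D:\ \mathcal U(x)\cap G\ne\emptyset\}$ is a Borel set for every open $G\subset\mathcal T$; 4. (shift invariance) for all $T>0$, $x\in D$ and $\Phi\in\mathcal U(x)$ one has $\Phi(T)\in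 D$ and $S_T\Phi\in\mathcal U(\Phi(T))$; 5. (continuation) for all $T>0$, $x\in D$, $\Phi_1\in\mathcal U(x)$ and $\Phi_2\in\mathcal U(\Phi_1(T))$ one has $\Phi_1\cup_T\Phi_2\in\mathcal U(x)$. Then there is a Borel measurable map $\mathfrak u:D\to\mathcal T$ with $\mathfrak u(x)\in\mathcal U(x)$ for every $x\in D$ which has the semigroup property: for all $x\in D$ and $t_1,t_2\ge 0$, $\mathfrak u(x)(t_1)\in D$ and $$\mathfrak u(x)(t_1+t_2)=\mathfrak u\big[\mathfrak u(x)(t_1)\big](t_2).$$ -/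

import Mathlib

open Set Filter Topology
open scoped NNReal

noncomputable section

/-- The completed graph on `[a, b]` of a left-continuous function `f` with right limits: the points
`(z, t)` with `t ∈ [a, b]` and `z` on the segment joining `f t = f (t-)` to `f (t+)`.
(Used below for functions that are constant near `a` and near `b`, so that nothing outside `[a, b]`
matters.) -/
def completedGraph (f : ℝ → ℝ) (a b : ℝ) : Set (ℝ × ℝ) :=
  {p | p.2 ∈ Icc a b ∧ p.1 ∈ uIcc (f p.2) (Function.rightLim f p.2)}

/-- The order on the completed graph: `(z₁, t₁) ≤ (z₂, t₂)` if `t₁ < t₂`, or if `t₁ = t₂` and `z₁` is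
at least as close to the left limit `f (t₁-) = f t₁` as `z₂`. -/
def graphLE (f : ℝ → ℝ) (p q : ℝ × ℝ) : Prop :=
  p.2 < q.2 ∨ (p.2 = q.2 ∧ |f p.2 - p.1| ≤ |f p.2 - q.1|)

/-- A parametric representation `s ↦ (u s, r s)` of the completed graph of `f` on `[a, b]`: a
continuous nondecreasing map of `[0, 1]` onto the completed graph. -/
structure IsParamRep (f : ℝ → ℝ) (a b : ℝ) (p : C(unitInterval, ℝ × ℝ)) : Prop where
  range_eq : range p = completedGraph f a b
  mono : ∀ s s' : unitInterval, s ≤ s' → graphLE f (p s) (p s')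

/-- The Skorokhod `M₁` distance on `[a, b]`: the infimum, over the parametric representations
`(u₁, r₁)` of `f` and `(u₂, r₂)` of `g`, of `max (‖u₁ - u₂‖_∞) (‖r₁ - r₂‖_∞)`, which is the uniform
distance in `C([0, 1], ℝ × ℝ)`. -/
def skorokhodM1Dist (a b : ℝ) (f g : ℝ → ℝ) : ℝ :=
  sInf {δ : ℝ | ∃ p q : C(unitInterval, ℝ × ℝ),
    IsParamRep f a b p ∧ IsParamRep g a b q ∧ δ = dist p q}

/-- The Skorokhod space `𝔇([0, ∞); H)` of càglàd functions. Its metric (below) is built from the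
scalar functions `⟨Φ, e k⟩`; the family `e` is therefore a parameter of the type. -/
@[ext]
structure SkorokhodSpace {H : Type*} [NormedAddCommGroup H] [InnerProductSpace ℝ H]
    (e : ℕ → H) where
  toFun : ℝ≥0 → H
  left_cont : ∀ t : ℝ≥0, 0 < t → Tendsto toFun (𝓝[<] t) (𝓝 (toFun t))
  right_lim : ∀ t : ℝ≥0, ∃ l : H, Tendsto toFun (𝓝[>] t) (𝓝 l)

namespace SkorokhodSpace

variable {H : Type*} [NormedAddCommGroup H] [InnerProductSpace ℝ H] {e : ℕ → H}

instance : CoeFun (SkorokhodSpace e) (fun _ => ℝ≥0 → H) := ⟨toFun⟩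

/-- The extension of `Φ|_[0, M]` to `[-1, M + 1]` by the constants `Φ 0` on `[-1, 0]` and `Φ M` on
`[M, M + 1]` (the same formula is used on all of `ℝ`). -/
def hat (Φ : SkorokhodSpace e) (M : ℕ) (t : ℝ) : H :=
  Φ (min (Real.toNNReal t) (M : ℝ≥0))

/-- The `M₁` distance on `[-1, M + 1]` between the `k`-th coordinates of the extensions. -/
def coordDist (M k : ℕ) (Φ Ψ : SkorokhodSpace e) : ℝ :=
  skorokhodM1Dist (-1) ((M : ℝ) + 1)
    (fun t => inner ℝ (Φ.hat M t) (e k)) (fun t => inner ℝ (Ψ.hat M t) (e k))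

/-- The distance `d_∞`; both sums of the definition start at `1`, whence the shift of `M` and of the
exponents (the family `e` is enumerated from `0`). -/
def dInfty (Φ Ψ : SkorokhodSpace e) : ℝ :=
  ∑' M : ℕ, ∑' k : ℕ, (1 / 2 : ℝ) ^ (M + 1) * (1 / 2 : ℝ) ^ (k + 1) *
    (coordDist (M + 1) k Φ Ψ / (1 + coordDist (M + 1) k Φ Ψ))

/-- The topology of the distance `d_∞`: a set is open if it contains a `d_∞`-ball around each of its
points. -/
instance : TopologicalSpace (SkorokhodSpace e) where
  IsOpen G := ∀ Φ ∈ G, ∃ ε > 0, ∀ Ψ, dInfty Φ Ψ < ε → Ψ ∈ G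
  isOpen_univ := fun _ _ => ⟨1, one_pos, fun _ _ => trivial⟩
  isOpen_inter := fun s t hs ht Φ hΦ => by
    obtain ⟨ε, hε, h1⟩ := hs Φ hΦ.1
    obtain ⟨δ, hδ, h2⟩ := ht Φ hΦ.2
    exact ⟨min ε δ, lt_min hε hδ, fun Ψ h =>
      ⟨h1 Ψ (h.trans_le (min_le_left _ _)), h2 Ψ (h.trans_le (min_le_right _ _))⟩⟩
  isOpen_sUnion := fun S hS Φ hΦ => by
    obtain ⟨s, hs, hΦs⟩ := hΦ
    obtain ⟨ε, hε, h⟩ := hS s hs Φ hΦs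
    exact ⟨ε, hε, fun Ψ hΨ => ⟨s, hs, h Ψ hΨ⟩⟩

/-- The Borel σ-algebra of the Skorokhod space. -/
instance : MeasurableSpace (SkorokhodSpace e) := borel _

instance : BorelSpace (SkorokhodSpace e) := ⟨rfl⟩

theorem tendsto_add_left_lt (T t : ℝ≥0) : Tendsto (fun s => T + s) (𝓝[<] t) (𝓝[<] (T + t)) :=
  tendsto_nhdsWithin_of_tendsto_nhds_of_eventually_within _
    ((continuous_const.add continuous_id).continuousWithinAt)
    (eventually_nhdsWithin_of_forall fun _ hs => add_lt_add_right (mem_Iio.1 hs) T)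

theorem tendsto_add_left_gt (T t : ℝ≥0) : Tendsto (fun s => T + s) (𝓝[>] t) (𝓝[>] (T + t)) :=
  tendsto_nhdsWithin_of_tendsto_nhds_of_eventually_within _
    ((continuous_const.add continuous_id).continuousWithinAt)
    (eventually_nhdsWithin_of_forall fun _ hs => add_lt_add_right (mem_Ioi.1 hs) T)

theorem tendsto_sub_lt {T t : ℝ≥0} (h : T < t) :
    Tendsto (fun s => s - T) (𝓝[<] t) (𝓝[<] (t - T)) := by
  refine tendsto_nhdsWithin_of_tendsto_nhds_of_eventually_within _
    ((continuous_id.sub continuous_const).continuousWithinAt) ?_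
  filter_upwards [self_mem_nhdsWithin, mem_nhdsWithin_of_mem_nhds (Ioi_mem_nhds h)] with s hs hTs
  exact tsub_lt_tsub_right_of_le (le_of_lt (mem_Ioi.1 hTs)) (mem_Iio.1 hs)

theorem tendsto_sub_gt {T t : ℝ≥0} (h : T ≤ t) :
    Tendsto (fun s => s - T) (𝓝[>] t) (𝓝[>] (t - T)) :=
  tendsto_nhdsWithin_of_tendsto_nhds_of_eventually_within _
    ((continuous_id.sub continuous_const).continuousWithinAt)
    (eventually_nhdsWithin_of_forall fun _ hs => tsub_lt_tsub_right_of_le h (mem_Ioi.1 hs))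

/-- The positive shift `(S_T Φ) t = Φ (T + t)`. -/
def shift (T : ℝ≥0) (Φ : SkorokhodSpace e) : SkorokhodSpace e where
  toFun t := Φ (T + t)
  left_cont t ht :=
    (Φ.left_cont (T + t) (add_pos_of_nonneg_of_pos (zero_le) ht)).comp (tendsto_add_left_lt T t)
  right_lim t := by
    obtain ⟨l, hl⟩ := Φ.right_lim (T + t)
    exact ⟨l, hl.comp (tendsto_add_left_gt T t)⟩

/-- The continuation `Φ₁ ∪_T Φ₂`, equal to `Φ₁ t` for `t ≤ T` and to `Φ₂ (t - T)` for `t > T`. -/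
def continuation (T : ℝ≥0) (Φ₁ Φ₂ : SkorokhodSpace e) : SkorokhodSpace e where
  toFun t := if t ≤ T then Φ₁ t else Φ₂ (t - T)
  left_cont t ht := by
    by_cases h : t ≤ T
    · rw [if_pos h]
      refine (Φ₁.left_cont t ht).congr' ?_
      filter_upwards [self_mem_nhdsWithin] with s hs
      rw [if_pos ((le_of_lt (mem_Iio.1 hs)).trans h)]
    · rw [if_neg h]
      rw [not_le] at h
      refine ((Φ₂.left_cont (t - T) (tsub_pos_of_lt h)).comp (tendsto_sub_lt h)).congr' ?_
      filter_upwards [mem_nhdsWithin_of_mem_nhds (Ioi_mem_nhds h)] with s hs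
      rw [if_neg (not_le.2 (mem_Ioi.1 hs))]
      rfl
  right_lim t := by
    by_cases h : t < T
    · obtain ⟨l, hl⟩ := Φ₁.right_lim t
      refine ⟨l, hl.congr' ?_⟩
      filter_upwards [mem_nhdsWithin_of_mem_nhds (Iio_mem_nhds h)] with s hs
      rw [if_pos (le_of_lt (mem_Iio.1 hs))]
    · rw [not_lt] at h
      obtain ⟨l, hl⟩ := Φ₂.right_lim (t - T)
      refine ⟨l, (hl.comp (tendsto_sub_gt h)).congr' ?_⟩
      filter_upwards [self_mem_nhdsWithin] with s hs
      rw [if_neg (not_le.2 (h.trans_lt (mem_Ioi.1 hs)))]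
      rfl

end SkorokhodSpace

/-- Borel measurability of a set-valued map: for every open `G`, the set of the points whose value
meets `G` is measurable. -/
def BorelMeasurableSetMap {X Y : Type*} [MeasurableSpace X] [TopologicalSpace Y]
    (U : X → Set Y) : Prop :=
  ∀ G : Set Y, IsOpen G → MeasurableSet {x | (U x ∩ G).Nonempty}

end

/-! This is Krylov's selection method. Maximizing a continuous functional over each `U x` leaves a
family of nonempty compact sets that is still measurable (`ClosedMeasurableSetMap.maximizers`). The
functionals are ζ(Φ) = ∫₀^∞ exp(-(n+1)t) arctan⟨Φ(t), e k⟩ dt. Splitting the integral at T shows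
that, once the path up to T is fixed, ζ is an increasing affine function of ζ of the tail
(`laplace_continuation`). By the dynamic programming principle the maximizers therefore inherit
shift invariance and stability under continuation.

Maximizing over all pairs (n, k) in succession gives a decreasing sequence of compact sets. Its
intersection is nonempty by compactness, and it is a single path because the initial value and the
transforms determine the path (`eq_of_laplace_eq`). Shift invariance of a family of singletons is
the semigroup property.

The analytic input is threefold. `dInfty` is a pseudometric: its triangle inequality compares two
parametrizations of the middle function through an injective one (`exists_reparam_near`). The
functionals are continuous: M₁ convergence gives pointwise convergence off the countable jump set of
the limit (`continuous_laplace`). Uniqueness follows from polynomial approximation in the variable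
exp(-t), together with left-continuity. -/

noncomputable section

/-! ### Càglàd functions and their jumps -/

/-- Real functions on the line that are left-continuous and have right limits everywhere. -/
structure IsCaglad (f : ℝ → ℝ) : Prop where
  left_cont : ∀ t, Tendsto f (𝓝[<] t) (𝓝 (f t))
  right_lim : ∀ t, ∃ l, Tendsto f (𝓝[>] t) (𝓝 l)

namespace IsCaglad

variable {f : ℝ → ℝ}

theorem tendsto_rightLim (hf : IsCaglad f) (t : ℝ) :
    Tendsto f (𝓝[>] t) (𝓝 (Function.rightLim f t)) :=
  tendsto_rightLim_of_tendsto (hf.right_lim t)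

theorem continuousAt (hf : IsCaglad f) {t : ℝ} (h : Function.rightLim f t = f t) :
    ContinuousAt f t :=
  continuousAt_iff_continuous_left'_right'.2
    ⟨hf.left_cont t, (congrArg (fun c => Tendsto f (𝓝[>] t) (𝓝 c)) h).mp (hf.tendsto_rightLim t)⟩

/-- Along a one-sided or full punctured neighbourhood, right limits of the function converge to the
same value as the function. -/
theorem tendsto_rightLim_of_isOpen (hf : IsCaglad f) {s : Set ℝ} (hs : IsOpen s) {t l : ℝ}
    (h : Tendsto f (𝓝[s] t) (𝓝 l)) : Tendsto (Function.rightLim f) (𝓝[s] t) (𝓝 l) := by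
  rw [(closed_nhds_basis l).tendsto_right_iff]
  rintro V ⟨hV, hVc⟩
  have h1 := eventually_eventually_nhdsWithin.2 (h.eventually hV)
  filter_upwards [h1, self_mem_nhdsWithin] with y hy hys
  refine hVc.mem_of_tendsto (hf.tendsto_rightLim y) ?_
  rw [hs.nhdsWithin_eq hys] at hy
  exact hy.filter_mono nhdsWithin_le_nhds

theorem neg (hf : IsCaglad f) : IsCaglad (fun t => -f t) :=
  ⟨fun t => (hf.left_cont t).neg, fun t => (hf.right_lim t).imp' _ fun _ h => h.neg⟩

theorem countable_lt_rightLim (hf : IsCaglad f) :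
    {t | f t < Function.rightLim f t}.Countable := by
  refine (countable_iUnion fun p : ℚ =>
    countable_image_lt_image_Ioi_within (Iio (p : ℝ)) f).mono ?_
  intro t (ht : f t < Function.rightLim f t)
  obtain ⟨z, hz1, hz2⟩ := exists_between ht
  obtain ⟨c, hc, hcz⟩ := mem_nhdsGT_iff_exists_Ioo_subset.1
    ((hf.tendsto_rightLim t).eventually (lt_mem_nhds hz2))
  obtain ⟨p, hp1, hp2⟩ := exists_rat_btwn (mem_Ioi.1 hc)
  exact mem_iUnion.2 ⟨p, hp1, z, hz1, fun y hy hty =>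
    le_of_lt (hcz ⟨hty, lt_trans hy hp2⟩)⟩

/-- A càglàd function has at most countably many jumps. -/
theorem countable_jumps (hf : IsCaglad f) : {t | Function.rightLim f t ≠ f t}.Countable := by
  refine (hf.countable_lt_rightLim.union hf.neg.countable_lt_rightLim).mono ?_
  intro t ht
  rcases lt_or_gt_of_ne ht with h | h
  · right
    have : Function.rightLim (fun t => -f t) t = -Function.rightLim f t :=
      rightLim_eq_of_tendsto (hf.tendsto_rightLim t).neg
    show -f t < Function.rightLim (fun t => -f t) t
    rw [this]
    linarith
  · exact Or.inl h

/-- The weight of a jump is the length of parameter interval on which it will be traversed;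
summability keeps the total added length finite. -/
theorem exists_jumpWeight (hf : IsCaglad f) : ∃ w : ℝ → ℝ, (∀ t, 0 ≤ w t) ∧ Summable w ∧
    ∀ t, w t = 0 ↔ Function.rightLim f t = f t := by
  obtain ⟨ε, hpos, c, hc, -⟩ := hf.countable_jumps.exists_pos_hasSum_le one_pos
  refine ⟨indicator {t | Function.rightLim f t ≠ f t} ε,
    fun t => indicator_nonneg (fun i _ => (hpos i).le) t,
    summable_subtype_iff_indicator.1 hc.summable, fun t => ?_⟩
  by_cases h : Function.rightLim f t = f t <;> simp [h, (hpos t).ne']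

end IsCaglad

/-! ### An injective parametrization of the completed graph -/

/-- The strictly increasing function `t ↦ t + ∑_{x < t} w x`. -/
def jumpTime (w : ℝ → ℝ) (t : ℝ) : ℝ := t + ∑' x, indicator (Iio t) w x

section JumpTime

variable {w : ℝ → ℝ}

theorem tsum_indicator_Iic (hw : Summable w) (t : ℝ) :
    ∑' x, indicator (Iic t) w x = ∑' x, indicator (Iio t) w x + w t := by
  have h : indicator (Iic t) w = indicator (Iio t) w + indicator {t} w := by
    rw [← Iio_union_right]
    exact indicator_union_of_disjoint (by simp) w
  have h1 : ∑' x, indicator {t} w x = w t := by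
    rw [tsum_eq_single t]
    · simp
    · intro b hb; simp [hb]
  rw [h, ← h1]
  exact (hw.indicator _).tsum_add (hw.indicator _)

/-- The fibres of distinct times are disjoint and ordered, with a gap of at least t' - t. Uniqueness
of the fibre time, its monotonicity and its Lipschitz bound all come from this inequality. -/
theorem jumpTime_add_lt (h0 : ∀ t, 0 ≤ w t) (hw : Summable w) {t t' : ℝ} (h : t < t') :
    jumpTime w t + w t + (t' - t) ≤ jumpTime w t' := by
  have h1 : ∑' x, indicator (Iic t) w x ≤ ∑' x, indicator (Iio t') w x :=
    (hw.indicator _).tsum_le_tsum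
      (fun x => indicator_le_indicator_of_subset (Iic_subset_Iio.2 h) h0 x) (hw.indicator _)
  rw [tsum_indicator_Iic hw] at h1
  unfold jumpTime
  linarith

theorem tendsto_jumpTime_left (h0 : ∀ t, 0 ≤ w t) (hw : Summable w) (t : ℝ) :
    Tendsto (jumpTime w) (𝓝[<] t) (𝓝 (jumpTime w t)) := by
  refine (tendsto_nhdsWithin_of_tendsto_nhds tendsto_id).add
    (tendsto_tsum_of_dominated_convergence hw (fun x => ?_) (Eventually.of_forall fun s x => ?_))
  · refine tendsto_const_nhds.congr' ?_
    by_cases h : x < t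
    · filter_upwards [mem_nhdsWithin_of_mem_nhds (Ioi_mem_nhds h)] with s hs
      rw [indicator_of_mem (mem_Iio.2 h), indicator_of_mem (mem_Iio.2 hs)]
    · filter_upwards [self_mem_nhdsWithin] with s hs
      rw [indicator_of_notMem (s := Iio t) h, indicator_of_notMem]
      exact fun h' => h (lt_trans h' hs)
  · rw [Real.norm_of_nonneg (indicator_nonneg (fun i _ => h0 i) x)]
    exact indicator_le_self' (fun _ _ => h0 _) x

theorem tendsto_jumpTime_right (h0 : ∀ t, 0 ≤ w t) (hw : Summable w) (t : ℝ) :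
    Tendsto (jumpTime w) (𝓝[>] t) (𝓝 (jumpTime w t + w t)) := by
  have h : jumpTime w t + w t = t + ∑' x, indicator (Iic t) w x := by
    rw [tsum_indicator_Iic hw, jumpTime, add_assoc]
  rw [h]
  refine (tendsto_nhdsWithin_of_tendsto_nhds tendsto_id).add
    (tendsto_tsum_of_dominated_convergence hw (fun x => ?_) (Eventually.of_forall fun s x => ?_))
  · refine tendsto_const_nhds.congr' ?_
    by_cases h : x ≤ t
    · filter_upwards [self_mem_nhdsWithin] with s hs
      rw [indicator_of_mem (mem_Iic.2 h), indicator_of_mem (mem_Iio.2 (h.trans_lt hs))]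
    · filter_upwards [mem_nhdsWithin_of_mem_nhds (Iio_mem_nhds (not_le.1 h))] with s hs
      rw [indicator_of_notMem (s := Iic t) h, indicator_of_notMem]
      exact fun h' => lt_asymm (mem_Iio.1 hs) h'
  · rw [Real.norm_of_nonneg (indicator_nonneg (fun i _ => h0 i) x)]
    exact indicator_le_self' (fun _ _ => h0 _) x

/-- The fibres `[jumpTime w t, jumpTime w t + w t]` cover the line. -/
theorem exists_mem_fibre (h0 : ∀ t, 0 ≤ w t) (hw : Summable w) (s : ℝ) :
    ∃ t, jumpTime w t ≤ s ∧ s ≤ jumpTime w t + w t := by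
  set S := {t | jumpTime w t ≤ s} with hS
  have hlow : ∃ t, t ∈ S := by
    -- `jumpTime` has slope at least 1, so moving left from 0 by the excess over s suffices.
    refine ⟨min 0 (s - jumpTime w 0), ?_⟩
    rcases le_or_gt (jumpTime w 0) s with h | h
    · rw [min_eq_left (by linarith)]; exact h
    · rw [min_eq_right (by linarith)]
      have := jumpTime_add_lt h0 hw (show s - jumpTime w 0 < 0 by linarith)
      have := h0 (s - jumpTime w 0)
      show jumpTime w _ ≤ s
      linarith
  have hbdd : BddAbove S := by
    refine ⟨max 0 (s - jumpTime w 0), fun t (ht : jumpTime w t ≤ s) => ?_⟩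
    by_contra! h
    rw [max_lt_iff] at h
    have := jumpTime_add_lt h0 hw h.1
    have := h0 0
    linarith
  -- Left-continuity of `jumpTime` at the supremum gives the lower bound; its right limit there, the
  -- end of the fibre, gives the upper bound.
  refine ⟨sSup S, ?_, ?_⟩
  · refine le_of_tendsto (tendsto_jumpTime_left h0 hw _) ?_
    filter_upwards [self_mem_nhdsWithin] with t ht
    obtain ⟨t', ht', htt'⟩ := exists_lt_of_lt_csSup hlow ht
    have := jumpTime_add_lt h0 hw htt'
    have := h0 t
    have : jumpTime w t' ≤ s := ht'
    linarith
  · refine ge_of_tendsto (tendsto_jumpTime_right h0 hw _) ?_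
    filter_upwards [self_mem_nhdsWithin] with t ht
    by_contra! h
    exact (not_le.2 (mem_Ioi.1 ht)) (le_csSup hbdd h.le)

/-- The (unique) time whose fibre contains `s`; a junk value if the weights are not summable. -/
def fibreTime (w : ℝ → ℝ) (s : ℝ) : ℝ :=
  Classical.epsilon fun t => jumpTime w t ≤ s ∧ s ≤ jumpTime w t + w t

theorem fibreTime_spec (h0 : ∀ t, 0 ≤ w t) (hw : Summable w) (s : ℝ) :
    jumpTime w (fibreTime w s) ≤ s ∧ s ≤ jumpTime w (fibreTime w s) + w (fibreTime w s) :=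
  Classical.epsilon_spec (exists_mem_fibre h0 hw s)

theorem fibreTime_mono (h0 : ∀ t, 0 ≤ w t) (hw : Summable w) : Monotone (fibreTime w) := by
  intro s s' h
  by_contra! h'
  have := jumpTime_add_lt h0 hw h'
  linarith [(fibreTime_spec h0 hw s).1, (fibreTime_spec h0 hw s').2]

theorem fibreTime_eq (h0 : ∀ t, 0 ≤ w t) (hw : Summable w) {s t : ℝ} (h1 : jumpTime w t ≤ s)
    (h2 : s ≤ jumpTime w t + w t) : fibreTime w s = t := by
  have h := fibreTime_spec h0 hw s
  rcases lt_trichotomy (fibreTime w s) t with h' | h' | h'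
  · linarith [jumpTime_add_lt h0 hw h']
  · exact h'
  · linarith [jumpTime_add_lt h0 hw h']

theorem continuous_fibreTime (h0 : ∀ t, 0 ≤ w t) (hw : Summable w) :
    Continuous (fibreTime w) := by
  refine (LipschitzWith.of_le_add fun s s' => ?_).continuous
  rcases le_or_gt (fibreTime w s) (fibreTime w s') with h | h
  · linarith [dist_nonneg (x := s) (y := s')]
  · have := jumpTime_add_lt h0 hw h
    rw [Real.dist_eq]
    linarith [(fibreTime_spec h0 hw s).1, (fibreTime_spec h0 hw s').2, le_abs_self (s - s')]

theorem jumpTime_mono (h0 : ∀ t, 0 ≤ w t) (hw : Summable w) : Monotone (jumpTime w) := by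
  refine fun t t' h => h.eq_or_lt.elim (fun h => h ▸ le_rfl) fun h => ?_
  linarith [jumpTime_add_lt h0 hw h, h0 t]

theorem jumpTime_add_mono (h0 : ∀ t, 0 ≤ w t) (hw : Summable w) :
    Monotone fun t => jumpTime w t + w t := by
  refine fun t t' h => h.eq_or_lt.elim (fun h => h ▸ le_rfl) fun h => ?_
  linarith [jumpTime_add_lt h0 hw h, h0 t']

end JumpTime

/-- The space component of the parametrization of the completed graph of `f`: linear on the fibre of
each time. -/
def fibreValue (f w : ℝ → ℝ) (s : ℝ) : ℝ :=
  f (fibreTime w s) + (s - jumpTime w (fibreTime w s)) / w (fibreTime w s) *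
    (Function.rightLim f (fibreTime w s) - f (fibreTime w s))

section FibreValue

variable {f w : ℝ → ℝ}

theorem fibreValue_of_mem (h0 : ∀ t, 0 ≤ w t) (hw : Summable w) {s t : ℝ}
    (h1 : jumpTime w t ≤ s) (h2 : s ≤ jumpTime w t + w t) :
    fibreValue f w s = f t + (s - jumpTime w t) / w t * (Function.rightLim f t - f t) := by
  rw [fibreValue, fibreTime_eq h0 hw h1 h2]

theorem fibreValue_left (h0 : ∀ t, 0 ≤ w t) (hw : Summable w) (t : ℝ) :
    fibreValue f w (jumpTime w t) = f t := by
  rw [fibreValue_of_mem h0 hw le_rfl (by linarith [h0 t])]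
  simp

theorem fibreValue_right (h0 : ∀ t, 0 ≤ w t) (hw : Summable w)
    (hwf : ∀ t, w t = 0 ↔ Function.rightLim f t = f t) (t : ℝ) :
    fibreValue f w (jumpTime w t + w t) = Function.rightLim f t := by
  rw [fibreValue_of_mem h0 hw (by linarith [h0 t]) le_rfl]
  by_cases h : w t = 0
  · simp [h, (hwf t).1 h]
  · field_simp
    ring

theorem fibreValue_mem_uIcc (h0 : ∀ t, 0 ≤ w t) (hw : Summable w) (s : ℝ) :
    fibreValue f w s ∈
      uIcc (f (fibreTime w s)) (Function.rightLim f (fibreTime w s)) := by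
  obtain ⟨h1, h2⟩ := fibreTime_spec h0 hw s
  rw [← segment_eq_uIcc, segment_eq_image']
  exact ⟨_, ⟨div_nonneg (by linarith) (h0 _), div_le_one_of_le₀ (by linarith) (h0 _)⟩, rfl⟩

/-- Inside a fibre the value is affine. At an end of a fibre, approached from outside, it is
squeezed between f and its right limit at the fibre time, and these share a one-sided limit. -/
theorem continuous_fibreValue (hf : IsCaglad f) (h0 : ∀ t, 0 ≤ w t) (hw : Summable w)
    (hwf : ∀ t, w t = 0 ↔ Function.rightLim f t = f t) : Continuous (fibreValue f w) := by
  have hsq : ∀ (l : Filter ℝ) (c : ℝ),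
      Tendsto (fun s => f (fibreTime w s)) l (𝓝 c) →
      Tendsto (fun s => Function.rightLim f (fibreTime w s)) l (𝓝 c) →
      Tendsto (fibreValue f w) l (𝓝 c) := by
    intro l c h1 h2
    have h3 := h1.min h2
    have h4 := h1.max h2
    rw [min_self] at h3
    rw [max_self] at h4
    exact tendsto_of_tendsto_of_tendsto_of_le_of_le h3 h4
      (fun s => (fibreValue_mem_uIcc h0 hw s).1) (fun s => (fibreValue_mem_uIcc h0 hw s).2)
  have haff : ∀ t : ℝ, Continuous fun s =>
      f t + (s - jumpTime w t) / w t * (Function.rightLim f t - f t) := fun t => by fun_prop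
  refine continuous_iff_continuousAt.2 fun s => ?_
  obtain ⟨h1, h2⟩ := fibreTime_spec h0 hw s
  set t := fibreTime w s with ht
  have hval := fibreValue_of_mem (f := f) h0 hw h1 h2
  have hcont : Tendsto (fibreTime w) (𝓝 s) (𝓝 t) := (continuous_fibreTime h0 hw).continuousAt
  refine continuousAt_iff_continuous_left'_right'.2 ⟨?_, ?_⟩
  · rcases h1.eq_or_lt with h | h
    · have hlt : Tendsto (fibreTime w) (𝓝[<] s) (𝓝[<] t) := by
        refine tendsto_nhdsWithin_of_tendsto_nhds_of_eventually_within _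
          (hcont.mono_left nhdsWithin_le_nhds) ?_
        filter_upwards [self_mem_nhdsWithin] with s' hs'
        refine lt_of_le_of_ne (fibreTime_mono h0 hw (le_of_lt hs')) fun he => ?_
        have := (fibreTime_spec h0 hw s').1
        rw [he] at this
        exact absurd hs' (not_lt.2 (h ▸ this))
      have hs : fibreValue f w s = f t := by rw [← h, fibreValue_left h0 hw]
      rw [ContinuousWithinAt, hs]
      exact hsq _ _ ((hf.left_cont t).comp hlt)
        ((hf.tendsto_rightLim_of_isOpen isOpen_Iio (hf.left_cont t)).comp hlt)
    · rw [ContinuousWithinAt, hval]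
      refine (((haff t).tendsto s).mono_left nhdsWithin_le_nhds).congr' ?_
      filter_upwards [self_mem_nhdsWithin, mem_nhdsWithin_of_mem_nhds (Ioi_mem_nhds h)]
        with s' hs' hs''
      exact (fibreValue_of_mem h0 hw (le_of_lt hs'') ((le_of_lt hs').trans h2)).symm
  · rcases h2.eq_or_lt with h | h
    · have hgt : Tendsto (fibreTime w) (𝓝[>] s) (𝓝[>] t) := by
        refine tendsto_nhdsWithin_of_tendsto_nhds_of_eventually_within _
          (hcont.mono_left nhdsWithin_le_nhds) ?_
        filter_upwards [self_mem_nhdsWithin] with s' hs'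
        refine lt_of_le_of_ne (fibreTime_mono h0 hw (le_of_lt hs')) fun he => ?_
        have := (fibreTime_spec h0 hw s').2
        rw [← he] at this
        exact absurd (mem_Ioi.1 hs') (not_lt.2 (this.trans h.ge))
      have hs : fibreValue f w s = Function.rightLim f t := by
        rw [h, fibreValue_right h0 hw hwf]
      rw [ContinuousWithinAt, hs]
      exact hsq _ _ ((hf.tendsto_rightLim t).comp hgt)
        ((hf.tendsto_rightLim_of_isOpen isOpen_Ioi (hf.tendsto_rightLim t)).comp hgt)
    · rw [ContinuousWithinAt, hval]
      refine (((haff t).tendsto s).mono_left nhdsWithin_le_nhds).congr' ?_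
      filter_upwards [self_mem_nhdsWithin, mem_nhdsWithin_of_mem_nhds (Iio_mem_nhds h)]
        with s' hs' hs''
      exact (fibreValue_of_mem h0 hw (h1.trans (le_of_lt hs')) (le_of_lt hs'')).symm

theorem abs_sub_fibreValue (h0 : ∀ t, 0 ≤ w t) (hw : Summable w) (s : ℝ) :
    |f (fibreTime w s) - fibreValue f w s| =
      (s - jumpTime w (fibreTime w s)) / w (fibreTime w s) *
        |Function.rightLim f (fibreTime w s) - f (fibreTime w s)| := by
  have h : f (fibreTime w s) - fibreValue f w s =
      -((s - jumpTime w (fibreTime w s)) / w (fibreTime w s) *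
        (Function.rightLim f (fibreTime w s) - f (fibreTime w s))) := by
    rw [fibreValue]; ring
  rw [h, abs_neg, abs_mul, abs_of_nonneg]
  exact div_nonneg (by linarith [(fibreTime_spec h0 hw s).1]) (h0 _)

theorem graphLE_fibre (h0 : ∀ t, 0 ≤ w t) (hw : Summable w) {s s' : ℝ} (h : s ≤ s') :
    graphLE f (fibreValue f w s, fibreTime w s) (fibreValue f w s', fibreTime w s') := by
  rcases (fibreTime_mono h0 hw h).lt_or_eq with h' | h'
  · exact Or.inl h'
  · refine Or.inr ⟨h', ?_⟩
    have h1 := abs_sub_fibreValue (f := f) h0 hw s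
    have h2 := abs_sub_fibreValue (f := f) h0 hw s'
    rw [← h'] at h2
    simp only
    rw [h1, h2]
    gcongr
    exact h0 _

theorem injective_fibre (h0 : ∀ t, 0 ≤ w t) (hw : Summable w)
    (hwf : ∀ t, w t = 0 ↔ Function.rightLim f t = f t) :
    Function.Injective fun s => (fibreValue f w s, fibreTime w s) := by
  intro s s' h
  obtain ⟨h1, h2⟩ := Prod.mk.inj h
  obtain ⟨h3, h4⟩ := fibreTime_spec h0 hw s
  obtain ⟨h5, h6⟩ := fibreTime_spec h0 hw s'
  rw [← h2] at h5 h6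
  by_cases hz : w (fibreTime w s) = 0
  · linarith
  · have hΔ : Function.rightLim f (fibreTime w s) - f (fibreTime w s) ≠ 0 :=
      sub_ne_zero.2 fun h => hz ((hwf _).2 h)
    rw [fibreValue, fibreValue, ← h2] at h1
    have h7 := mul_right_cancel₀ hΔ (add_left_cancel h1)
    rw [div_left_inj' hz] at h7
    linarith

/-- The completed graph of a càglàd function on a nondegenerate interval has an injective
parametric representation. -/
theorem IsCaglad.exists_injective_isParamRep (hf : IsCaglad f) {a b : ℝ} (hab : a < b) :
    ∃ p : C(unitInterval, ℝ × ℝ), IsParamRep f a b p ∧ Function.Injective p := by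
  obtain ⟨w, h0, hw, hwf⟩ := hf.exists_jumpWeight
  -- [A, B] runs from the start of the fibre of a to the end of the fibre of b, so a jump at b is
  -- included.
  set A := jumpTime w a
  set B := jumpTime w b + w b
  have hAB : A < B := by linarith [jumpTime_add_lt h0 hw hab, h0 a, h0 b]
  let p : C(unitInterval, ℝ × ℝ) :=
    ⟨fun x => (fibreValue f w (A + (B - A) * x), fibreTime w (A + (B - A) * x)),
      ((continuous_fibreValue hf h0 hw hwf).prodMk (continuous_fibreTime h0 hw)).comp
        (by fun_prop)⟩
  refine ⟨p, ⟨?_, ?_⟩, ?_⟩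
  · ext ⟨z, t⟩
    constructor
    · rintro ⟨x, hx⟩
      obtain ⟨h1, h2⟩ := Prod.mk.inj hx
      subst h1 h2
      refine ⟨⟨?_, ?_⟩, fibreValue_mem_uIcc h0 hw _⟩
      · have : fibreTime w A = a := fibreTime_eq h0 hw le_rfl (by linarith [h0 a])
        calc a = fibreTime w A := this.symm
          _ ≤ _ := fibreTime_mono h0 hw (by nlinarith [x.2.1])
      · have : fibreTime w B = b := fibreTime_eq h0 hw (by simp [B, h0 b]) le_rfl
        calc _ ≤ fibreTime w B := fibreTime_mono h0 hw (by nlinarith [x.2.2])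
          _ = b := this
    · rintro ⟨⟨ha, hb⟩, hz⟩
      simp only at ha hb hz
      rw [← segment_eq_uIcc, segment_eq_image'] at hz
      obtain ⟨θ, ⟨hθ0, hθ1⟩, rfl⟩ := hz
      have hs1 : jumpTime w t ≤ jumpTime w t + θ * w t := by nlinarith [h0 t]
      have hs2 : jumpTime w t + θ * w t ≤ jumpTime w t + w t := by nlinarith [h0 t]
      have hA : A ≤ jumpTime w t + θ * w t := (jumpTime_mono h0 hw ha).trans hs1
      have hB : jumpTime w t + θ * w t ≤ B := hs2.trans (jumpTime_add_mono h0 hw hb)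
      have hBA : B - A ≠ 0 := (sub_pos.2 hAB).ne'
      have hx : A + (B - A) * ((jumpTime w t + θ * w t - A) / (B - A)) =
        jumpTime w t + θ * w t := by field_simp; ring
      refine ⟨⟨(jumpTime w t + θ * w t - A) / (B - A),
        div_nonneg (by linarith) (by linarith), div_le_one_of_le₀ (by linarith) (by linarith)⟩, ?_⟩
      show (fibreValue f w (A + (B - A) * ((jumpTime w t + θ * w t - A) / (B - A))),
        fibreTime w (A + (B - A) * ((jumpTime w t + θ * w t - A) / (B - A)))) = _
      rw [hx, fibreTime_eq h0 hw hs1 hs2, fibreValue_of_mem h0 hw hs1 hs2]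
      by_cases h : w t = 0
      · simp [h, (hwf t).1 h]
      · congr 1
        simp only [smul_eq_mul]
        field_simp
        ring
  · intro x y hxy
    exact graphLE_fibre h0 hw (by
      have : (x : ℝ) ≤ y := hxy
      nlinarith)
  · intro x y hxy
    have := injective_fibre h0 hw hwf hxy
    exact Subtype.ext (mul_left_cancel₀ (sub_pos.2 hAB).ne' (add_left_cancel this))

end FibreValue

/-! ### Reparametrization and the triangle inequality for M₁ -/

/-- On the completed graph, the order is antisymmetric. -/
theorem graphLE_antisymm {f : ℝ → ℝ} {a b : ℝ} {p q : ℝ × ℝ} (hp : p ∈ completedGraph f a b)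
    (hq : q ∈ completedGraph f a b) (h1 : graphLE f p q) (h2 : graphLE f q p) : p = q := by
  obtain ⟨z, t⟩ := p
  obtain ⟨z', t'⟩ := q
  rcases h1 with h1 | ⟨h1, h3⟩
  · rcases h2 with h2 | ⟨h2, -⟩
    · exact absurd h1 (lt_asymm h2)
    · exact absurd h1 (h2 ▸ lt_irrefl _)
  · simp only at h1
    subst h1
    rcases h2 with h2 | ⟨-, h4⟩
    · exact absurd h2 (lt_irrefl _)
    have h := le_antisymm h3 h4
    have h5 := hp.2
    have h6 := hq.2
    simp only [mem_uIcc] at h h5 h6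
    congr 1
    -- Equal distances from f t could come from opposite sides, but both points lie on a segment
    -- having f t as an endpoint.
    rcases abs_eq_abs.1 h with h | h
    · linarith
    · rcases h5 with h5 | h5 <;> rcases h6 with h6 | h6 <;> linarith

namespace IsParamRep

variable {f : ℝ → ℝ} {a b : ℝ} {p q : C(unitInterval, ℝ × ℝ)}

theorem mem (hp : IsParamRep f a b p) (s : unitInterval) : p s ∈ completedGraph f a b :=
  hp.range_eq ▸ mem_range_self s

theorem comp (hp : IsParamRep f a b p) {α : C(unitInterval, unitInterval)} (hm : Monotone α)
    (hs : Function.Surjective α) : IsParamRep f a b (p.comp α) where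
  range_eq := (hs.range_comp p).trans hp.range_eq
  mono _ _ h := hp.mono _ _ (hm h)

/-- Every parametric representation factors through an injective one. -/
theorem exists_factor (hp : IsParamRep f a b p) (hpi : Function.Injective p)
    (hq : IsParamRep f a b q) : ∃ μ : C(unitInterval, unitInterval),
      Monotone μ ∧ Function.Surjective μ ∧ ∀ s, p (μ s) = q s := by
  have hex : ∀ s, ∃ x, p x = q s := fun s => by
    have := hq.mem s
    rwa [← hp.range_eq] at this
  choose μ hμ using hex
  -- An injective continuous map from a compact space to a Hausdorff space is an embedding, so μ
  -- inherits continuity from q.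
  have hcont : Continuous μ := by
    rw [(p.continuous.isClosedEmbedding hpi).isEmbedding.continuous_iff]
    exact q.continuous.congr fun s => (hμ s).symm
  refine ⟨⟨μ, hcont⟩, fun s s' hs => ?_, fun x => ?_, hμ⟩
  · by_contra! hlt
    have h1 := hp.mono _ _ hlt.le
    have h2 := hq.mono _ _ hs
    simp only [ContinuousMap.coe_mk] at h1 hlt
    rw [hμ, hμ] at h1
    have h3 := graphLE_antisymm (hq.mem _) (hq.mem _) h2 h1
    rw [← hμ, ← hμ] at h3
    exact hlt.ne (hpi h3).symm
  · have := hp.mem x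
    rw [← hq.range_eq] at this
    obtain ⟨s, hs⟩ := this
    exact ⟨s, hpi ((hμ s).trans hs)⟩

end IsParamRep

/-- A monotone continuous surjection of the unit interval is within any `ε` of an order
isomorphism. -/
theorem exists_orderIso_near (μ : C(unitInterval, unitInterval)) (hμ : Monotone μ)
    (hs : Function.Surjective μ) {ε : ℝ} (hε : 0 < ε) :
    ∃ α : unitInterval ≃o unitInterval, ∀ s, dist (μ s) (α s) ≤ ε := by
  have h0 : μ 0 = 0 := by
    obtain ⟨x, hx⟩ := hs 0
    exact le_antisymm ((hμ (show 0 ≤ x from x.2.1)).trans_eq hx) (μ 0).2.1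
  have h1 : μ 1 = 1 := by
    obtain ⟨x, hx⟩ := hs 1
    exact le_antisymm (μ 1).2.2 (hx.ge.trans (hμ (show x ≤ 1 from x.2.2)))
  -- The convex combination (1 - c) μ + c · id is strictly increasing and moves each point by at
  -- most c.
  set c := min ε 1 with hc
  have hc0 : 0 < c := lt_min hε one_pos
  have hc1 : c ≤ 1 := min_le_right _ _
  have hmem : ∀ s : unitInterval, (1 - c) * (μ s : ℝ) + c * s ∈ unitInterval := fun s =>
    ⟨by nlinarith [(μ s).2.1, s.2.1], by nlinarith [(μ s).2.2, s.2.2]⟩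
  let m : unitInterval → unitInterval := fun s => ⟨(1 - c) * (μ s : ℝ) + c * s, hmem s⟩
  have hmc : Continuous m := by
    refine Continuous.subtype_mk ?_ _
    have := μ.continuous
    fun_prop
  have hmm : StrictMono m := fun s s' h => by
    have h2 : (μ s : ℝ) ≤ μ s' := hμ h.le
    have h3 : (s : ℝ) < s' := h
    show (1 - c) * (μ s : ℝ) + c * s < (1 - c) * (μ s' : ℝ) + c * s'
    nlinarith
  have hm0 : m 0 = 0 := Subtype.ext (by simp [m, h0])
  have hm1 : m 1 = 1 := Subtype.ext (by simp [m, h1])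
  have hsurj : Function.Surjective m := fun y =>
    mem_range_of_exists_le_of_exists_ge hmc ⟨0, hm0.trans_le y.2.1⟩ ⟨1, hm1.ge.trans' y.2.2⟩
  refine ⟨StrictMono.orderIsoOfSurjective m hmm hsurj, fun s => ?_⟩
  show |(μ s : ℝ) - ((1 - c) * (μ s : ℝ) + c * s)| ≤ ε
  have hcε : c ≤ ε := min_le_left _ _
  have e1 : (μ s : ℝ) - ((1 - c) * (μ s : ℝ) + c * s) = c * (μ s - s) := by ring
  rw [e1, abs_mul, abs_of_pos hc0]
  have : |(μ s : ℝ) - s| ≤ 1 :=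
    abs_le.2 ⟨by linarith [(μ s).2.1, s.2.2], by linarith [(μ s).2.2, s.2.1]⟩
  nlinarith

/-- Up to an arbitrarily small error, every parametric representation is a homeomorphic
reparametrization of a given injective one. -/
theorem IsParamRep.exists_reparam_near {f : ℝ → ℝ} {a b : ℝ} {p q : C(unitInterval, ℝ × ℝ)}
    (hp : IsParamRep f a b p) (hpi : Function.Injective p) (hq : IsParamRep f a b q) {ε : ℝ}
    (hε : 0 < ε) :
    ∃ α : C(unitInterval, unitInterval), Monotone α ∧ Function.Surjective α ∧
      dist (q.comp α) p ≤ ε := by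
  obtain ⟨μ, hμm, hμs, hμ⟩ := hp.exists_factor hpi hq
  obtain ⟨δ, hδ, hδp⟩ := Metric.uniformContinuous_iff.1
    (CompactSpace.uniformContinuous_of_continuous p.continuous) ε hε
  obtain ⟨β, hβ⟩ := exists_orderIso_near μ hμm hμs (half_pos hδ)
  -- Since q = p ∘ μ, composing with β⁻¹ gives p ∘ (μ ∘ β⁻¹), where μ ∘ β⁻¹ is uniformly close to
  -- the identity.
  refine ⟨⟨β.symm, β.symm.continuous⟩, β.symm.monotone, β.symm.surjective,
    (ContinuousMap.dist_le hε.le).2 fun s => ?_⟩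
  have h := hβ (β.symm s)
  rw [OrderIso.apply_symm_apply] at h
  show dist (q (β.symm s)) (p s) ≤ ε
  rw [← hμ]
  exact (hδp (h.trans_lt (half_lt_self hδ))).le

section Dist

variable {f g h : ℝ → ℝ} {a b : ℝ}

theorem skorokhodM1Dist_bddBelow (f g : ℝ → ℝ) (a b : ℝ) :
    BddBelow {δ : ℝ | ∃ p q : C(unitInterval, ℝ × ℝ),
      IsParamRep f a b p ∧ IsParamRep g a b q ∧ δ = dist p q} :=
  ⟨0, by rintro _ ⟨p, q, -, -, rfl⟩; exact dist_nonneg⟩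

theorem skorokhodM1Dist_le {p q : C(unitInterval, ℝ × ℝ)} (hp : IsParamRep f a b p)
    (hq : IsParamRep g a b q) : skorokhodM1Dist a b f g ≤ dist p q :=
  csInf_le (skorokhodM1Dist_bddBelow f g a b) ⟨p, q, hp, hq, rfl⟩

theorem skorokhodM1Dist_nonneg (a b : ℝ) (f g : ℝ → ℝ) : 0 ≤ skorokhodM1Dist a b f g :=
  Real.sInf_nonneg (by rintro _ ⟨p, q, -, -, rfl⟩; exact dist_nonneg)

theorem skorokhodM1Dist_comm (a b : ℝ) (f g : ℝ → ℝ) :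
    skorokhodM1Dist a b f g = skorokhodM1Dist a b g f := by
  unfold skorokhodM1Dist
  congr 1
  ext δ
  constructor <;> rintro ⟨p, q, hp, hq, rfl⟩ <;> exact ⟨q, p, hq, hp, dist_comm _ _⟩

/-- The existence of representations is essential here: over an empty set the real infimum would be
the default value 0. -/
theorem exists_dist_lt_of_skorokhodM1Dist_lt (hf : IsCaglad f) (hg : IsCaglad g) (hab : a < b)
    {δ : ℝ} (hδ : skorokhodM1Dist a b f g < δ) : ∃ p q : C(unitInterval, ℝ × ℝ),
      IsParamRep f a b p ∧ IsParamRep g a b q ∧ dist p q < δ := by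
  obtain ⟨p, hp, -⟩ := hf.exists_injective_isParamRep hab
  obtain ⟨q, hq, -⟩ := hg.exists_injective_isParamRep hab
  obtain ⟨_, ⟨p', q', hp', hq', rfl⟩, hlt⟩ := exists_lt_of_csInf_lt (s := {δ : ℝ |
    ∃ p q : C(unitInterval, ℝ × ℝ), IsParamRep f a b p ∧ IsParamRep g a b q ∧ δ = dist p q})
    ⟨_, p, q, hp, hq, rfl⟩ hδ
  exact ⟨p', q', hp', hq', hlt⟩

theorem skorokhodM1Dist_self (hf : IsCaglad f) (hab : a < b) : skorokhodM1Dist a b f f = 0 := by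
  obtain ⟨p, hp, -⟩ := hf.exists_injective_isParamRep hab
  exact le_antisymm ((skorokhodM1Dist_le hp hp).trans_eq (dist_self p))
    (skorokhodM1Dist_nonneg _ _ _ _)

theorem skorokhodM1Dist_triangle (hf : IsCaglad f) (hg : IsCaglad g) (hh : IsCaglad h)
    (hab : a < b) : skorokhodM1Dist a b f h ≤
      skorokhodM1Dist a b f g + skorokhodM1Dist a b g h := by
  refine le_of_forall_pos_le_add fun ε hε => ?_
  have hε4 : 0 < ε / 4 := by positivity
  obtain ⟨p, q, hp, hq, hpq⟩ := exists_dist_lt_of_skorokhodM1Dist_lt hf hg hab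
    (lt_add_of_pos_right (skorokhodM1Dist a b f g) hε4)
  obtain ⟨q', r, hq', hr, hqr⟩ := exists_dist_lt_of_skorokhodM1Dist_lt hg hh hab
    (lt_add_of_pos_right (skorokhodM1Dist a b g h) hε4)
  -- The representations q and q' of g need not agree; both are brought close to the common P, at a
  -- cost of ε/4 each.
  obtain ⟨P, hP, hPi⟩ := hg.exists_injective_isParamRep hab
  obtain ⟨α, hαm, hαs, hα⟩ := hP.exists_reparam_near hPi hq hε4
  obtain ⟨β, hβm, hβs, hβ⟩ := hP.exists_reparam_near hPi hq' hε4
  have hcomp : ∀ (γ : C(unitInterval, unitInterval)) (x y : C(unitInterval, ℝ × ℝ)),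
      dist (x.comp γ) (y.comp γ) ≤ dist x y := fun γ x y =>
    (ContinuousMap.dist_le dist_nonneg).2 fun s => ContinuousMap.dist_apply_le_dist (γ s)
  have h1 := skorokhodM1Dist_le (hp.comp hαm hαs) (hr.comp hβm hβs)
  have h2 := hcomp α p q
  have h3 := hcomp β q' r
  have h4 := dist_triangle4 (p.comp α) (q.comp α) (q'.comp β) (r.comp β)
  have h5 := dist_triangle_right (q.comp α) (q'.comp β) P
  linarith

end Dist

/-! ### The pseudometric on path space -/

namespace IsCaglad

/-- Stopping a càglàd function at time `M` gives a càglàd function. -/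
theorem comp_min {f : ℝ → ℝ} (hf : IsCaglad f) (M : ℝ) : IsCaglad (fun t => f (min t M)) := by
  refine ⟨fun t => ?_, fun t => ?_⟩
  · rcases le_or_gt t M with h | h
    · rw [min_eq_left h]
      refine (hf.left_cont t).congr' ?_
      filter_upwards [self_mem_nhdsWithin] with s hs
      rw [min_eq_left ((le_of_lt hs).trans h)]
    · refine tendsto_const_nhds.congr' ?_
      filter_upwards [mem_nhdsWithin_of_mem_nhds (Ioi_mem_nhds h)] with s hs
      rw [min_eq_right h.le, min_eq_right (le_of_lt hs)]
  · rcases lt_or_ge t M with h | h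
    · obtain ⟨l, hl⟩ := hf.right_lim t
      refine ⟨l, hl.congr' ?_⟩
      filter_upwards [mem_nhdsWithin_of_mem_nhds (Iio_mem_nhds h)] with s hs
      rw [min_eq_left (le_of_lt hs)]
    · refine ⟨f M, tendsto_const_nhds.congr' ?_⟩
      filter_upwards [self_mem_nhdsWithin] with s hs
      rw [min_eq_right (h.trans (le_of_lt hs))]

end IsCaglad

namespace SkorokhodSpace

variable {H : Type*} [NormedAddCommGroup H] [InnerProductSpace ℝ H] {e : ℕ → H}

/-- The `k`-th coordinate of a path, extended to negative times by its initial value. -/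
def coord (Φ : SkorokhodSpace e) (k : ℕ) (t : ℝ) : ℝ := inner ℝ (Φ t.toNNReal) (e k)

theorem isCaglad_coord (Φ : SkorokhodSpace e) (k : ℕ) : IsCaglad (Φ.coord k) := by
  have hin : Continuous fun v : H => inner ℝ v (e k) := by fun_prop
  refine ⟨fun t => ?_, fun t => ?_⟩
  · rcases le_or_gt t 0 with h | h
    · refine tendsto_const_nhds.congr' ?_
      filter_upwards [self_mem_nhdsWithin] with s hs
      rw [coord, coord, Real.toNNReal_of_nonpos h, Real.toNNReal_of_nonpos ((le_of_lt hs).trans h)]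
    · refine ((hin.tendsto _).comp (Φ.left_cont t.toNNReal (Real.toNNReal_pos.2 h))).comp
        (tendsto_nhdsWithin_of_tendsto_nhds_of_eventually_within _
          (continuous_real_toNNReal.continuousAt.tendsto.mono_left nhdsWithin_le_nhds) ?_)
      filter_upwards [self_mem_nhdsWithin] with s hs
      exact (Real.toNNReal_lt_toNNReal_iff h).2 hs
  · rcases lt_or_ge t 0 with h | h
    · refine ⟨Φ.coord k 0, tendsto_const_nhds.congr' ?_⟩
      filter_upwards [mem_nhdsWithin_of_mem_nhds (Iio_mem_nhds h)] with s hs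
      rw [coord, coord, Real.toNNReal_of_nonpos (le_of_lt hs), Real.toNNReal_zero]
    · obtain ⟨l, hl⟩ := Φ.right_lim t.toNNReal
      refine ⟨_, ((hin.tendsto _).comp hl).comp
        (tendsto_nhdsWithin_of_tendsto_nhds_of_eventually_within _
          (continuous_real_toNNReal.continuousAt.tendsto.mono_left nhdsWithin_le_nhds) ?_)⟩
      filter_upwards [self_mem_nhdsWithin] with s hs
      exact (Real.toNNReal_lt_toNNReal_iff (h.trans_lt hs)).2 hs

theorem inner_hat (Φ : SkorokhodSpace e) (M k : ℕ) (t : ℝ) :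
    inner ℝ (Φ.hat M t) (e k) = Φ.coord k (min t M) := by
  have h : (min t (M : ℝ)).toNNReal = min t.toNNReal M := by
    rw [Monotone.map_min (f := Real.toNNReal) (fun _ _ => Real.toNNReal_le_toNNReal),
      Real.toNNReal_natCast]
  rw [hat, coord, h]

theorem isCaglad_inner_hat (Φ : SkorokhodSpace e) (M k : ℕ) :
    IsCaglad fun t => inner ℝ (Φ.hat M t) (e k) := by
  simp_rw [inner_hat]
  exact (Φ.isCaglad_coord k).comp_min M

theorem neg_one_lt_cast_add_one (M : ℕ) : (-1 : ℝ) < (M : ℝ) + 1 := by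
  have : (0 : ℝ) ≤ M := M.cast_nonneg
  linarith

variable (Φ Ψ Ξ : SkorokhodSpace e) (M k : ℕ)

theorem coordDist_nonneg : 0 ≤ coordDist M k Φ Ψ := skorokhodM1Dist_nonneg _ _ _ _

theorem coordDist_self : coordDist M k Φ Φ = 0 :=
  skorokhodM1Dist_self (Φ.isCaglad_inner_hat M k) (neg_one_lt_cast_add_one M)

theorem coordDist_comm : coordDist M k Φ Ψ = coordDist M k Ψ Φ := skorokhodM1Dist_comm _ _ _ _

theorem coordDist_triangle : coordDist M k Φ Ξ ≤ coordDist M k Φ Ψ + coordDist M k Ψ Ξ :=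
  skorokhodM1Dist_triangle (Φ.isCaglad_inner_hat M k) (Ψ.isCaglad_inner_hat M k)
    (Ξ.isCaglad_inner_hat M k) (neg_one_lt_cast_add_one M)

/-- The summand of index `(M, k)` of the distance `dInfty`. -/
def term (M k : ℕ) (Φ Ψ : SkorokhodSpace e) : ℝ :=
  (1 / 2 : ℝ) ^ (M + 1) * (1 / 2 : ℝ) ^ (k + 1) *
    (coordDist (M + 1) k Φ Ψ / (1 + coordDist (M + 1) k Φ Ψ))

theorem term_nonneg : 0 ≤ term M k Φ Ψ := by
  have := coordDist_nonneg Φ Ψ (M + 1) k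
  unfold term
  positivity

theorem term_le : term M k Φ Ψ ≤ (1 / 2 : ℝ) ^ (M + 1) * (1 / 2 : ℝ) ^ (k + 1) := by
  have := coordDist_nonneg Φ Ψ (M + 1) k
  refine mul_le_of_le_one_right (by positivity) (div_le_one_of_le₀ ?_ ?_) <;> linarith

theorem term_triangle : term M k Φ Ξ ≤ term M k Φ Ψ + term M k Ψ Ξ := by
  have h1 := coordDist_nonneg Φ Ψ (M + 1) k
  have h2 := coordDist_nonneg Ψ Ξ (M + 1) k
  have h3 := coordDist_nonneg Φ Ξ (M + 1) k
  have h4 := coordDist_triangle Φ Ψ Ξ (M + 1) k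
  unfold term
  rw [← mul_add]
  generalize coordDist (M + 1) k Φ Ψ = x at *
  generalize coordDist (M + 1) k Ψ Ξ = y at *
  generalize coordDist (M + 1) k Φ Ξ = z at *
  refine mul_le_mul_of_nonneg_left ?_ (by positivity)
  calc z / (1 + z) ≤ (x + y) / (1 + (x + y)) := by
        rw [div_le_div_iff₀ (by positivity) (by positivity)]; nlinarith
    _ = x / (1 + (x + y)) + y / (1 + (x + y)) := add_div _ _ _
    _ ≤ x / (1 + x) + y / (1 + y) := by
        gcongr <;> linarith

theorem summable_half_pow : Summable fun k : ℕ => (1 / 2 : ℝ) ^ (k + 1) :=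
  (summable_nat_add_iff 1).2 summable_geometric_two

theorem summable_term : Summable fun k => term M k Φ Ψ :=
  Summable.of_nonneg_of_le (fun k => term_nonneg Φ Ψ M k) (fun k => term_le Φ Ψ M k)
    (summable_half_pow.mul_left _)

theorem summable_tsum_term : Summable fun M => ∑' k, term M k Φ Ψ := by
  refine Summable.of_nonneg_of_le (fun M => tsum_nonneg fun k => term_nonneg Φ Ψ M k)
    (fun M => (summable_term Φ Ψ M).tsum_le_tsum (fun k => term_le Φ Ψ M k)
      (summable_half_pow.mul_left _)) ?_
  simp_rw [tsum_mul_left]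
  exact summable_half_pow.mul_right _

theorem dInfty_eq : dInfty Φ Ψ = ∑' M, ∑' k, term M k Φ Ψ := rfl

theorem term_le_dInfty : term M k Φ Ψ ≤ dInfty Φ Ψ :=
  ((summable_term Φ Ψ M).le_tsum k fun k _ => term_nonneg Φ Ψ M k).trans
    ((summable_tsum_term Φ Ψ).le_tsum M fun M _ => tsum_nonneg fun k => term_nonneg Φ Ψ M k)

theorem dInfty_self : dInfty Φ Φ = 0 := by
  simp [dInfty_eq, term, coordDist_self]

theorem dInfty_comm : dInfty Φ Ψ = dInfty Ψ Φ := by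
  simp only [dInfty_eq, term, coordDist_comm Φ Ψ]

theorem dInfty_triangle : dInfty Φ Ξ ≤ dInfty Φ Ψ + dInfty Ψ Ξ := by
  rw [dInfty_eq, dInfty_eq, dInfty_eq,
    ← (summable_tsum_term Φ Ψ).tsum_add (summable_tsum_term Ψ Ξ)]
  refine (summable_tsum_term Φ Ξ).tsum_le_tsum (fun M => ?_)
    ((summable_tsum_term Φ Ψ).add (summable_tsum_term Ψ Ξ))
  rw [← (summable_term Φ Ψ M).tsum_add (summable_term Ψ Ξ M)]
  exact (summable_term Φ Ξ M).tsum_le_tsum (fun k => term_triangle Φ Ψ Ξ M k)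
    ((summable_term Φ Ψ M).add (summable_term Ψ Ξ M))

/-- The topology already declared is kept. Separation of points is obtained later, in `t2Space`,
from continuous functionals. -/
instance : PseudoMetricSpace (SkorokhodSpace e) :=
  PseudoMetricSpace.ofDistTopology dInfty dInfty_self dInfty_comm dInfty_triangle fun _ => Iff.rfl

theorem tendsto_coordDist : Tendsto (fun Ψ => coordDist (M + 1) k Φ Ψ) (𝓝 Φ) (𝓝 0) := by
  have h0 : Tendsto (fun Ψ => dist Φ Ψ) (𝓝 Φ) (𝓝 0) := by
    have : Continuous fun Ψ => dist Φ Ψ := by fun_prop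
    simpa using this.tendsto Φ
  have h1 : Tendsto (fun Ψ => term M k Φ Ψ) (𝓝 Φ) (𝓝 0) :=
    squeeze_zero (fun Ψ => term_nonneg Φ Ψ M k) (fun Ψ => term_le_dInfty Φ Ψ M k) h0
  set c : ℝ := (1 / 2 : ℝ) ^ (M + 1) * (1 / 2 : ℝ) ^ (k + 1) with hc
  have hcpos : 0 < c := by positivity
  have h2 : Tendsto (fun Ψ => term M k Φ Ψ / c) (𝓝 Φ) (𝓝 0) := by
    simpa using h1.div_const c
  -- y ↦ y / (1 - y) inverts x ↦ x / (1 + x).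
  have h3 : Tendsto (fun Ψ => (term M k Φ Ψ / c) / (1 - term M k Φ Ψ / c)) (𝓝 Φ) (𝓝 0) := by
    have := h2.div (tendsto_const_nhds.sub h2) (show (1 : ℝ) - 0 ≠ 0 by norm_num)
    rwa [zero_div] at this
  refine h3.congr fun Ψ => ?_
  have h4 := coordDist_nonneg Φ Ψ (M + 1) k
  rw [term, ← hc, mul_div_cancel_left₀ _ hcpos.ne']
  field_simp
  ring

end SkorokhodSpace

/-! ### Continuity of the Laplace functionals -/

theorem IsCaglad.aestronglyMeasurable {f : ℝ → ℝ} (hf : IsCaglad f) :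
    MeasureTheory.AEStronglyMeasurable f MeasureTheory.volume := by
  have hc : ContinuousOn f {t | Function.rightLim f t ≠ f t}ᶜ := fun t ht =>
    (hf.continuousAt (not_not.1 ht)).continuousWithinAt
  have := hc.aestronglyMeasurable (μ := MeasureTheory.volume)
    hf.countable_jumps.measurableSet.compl
  rwa [MeasureTheory.Measure.restrict_eq_self_of_ae_mem (s := {t | Function.rightLim f t ≠ f t}ᶜ)
    (hf.countable_jumps.ae_notMem MeasureTheory.volume)] at this

/-- Convergence in the `M₁` distance implies pointwise convergence at the continuity points of the
limit. -/
theorem tendsto_apply_of_tendsto_skorokhodM1Dist {ι : Type*} {l : Filter ι} {f : ℝ → ℝ}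
    {g : ι → ℝ → ℝ} (hf : IsCaglad f) (hg : ∀ i, IsCaglad (g i)) {a b t : ℝ} (hab : a < b)
    (ht : t ∈ Icc a b) (hft : ContinuousAt f t)
    (h : Tendsto (fun i => skorokhodM1Dist a b f (g i)) l (𝓝 0)) :
    Tendsto (fun i => g i t) l (𝓝 (f t)) := by
  rw [Metric.tendsto_nhds]
  intro ε hε
  have h1 : Tendsto f (𝓝[univ] t) (𝓝 (f t)) := by rwa [nhdsWithin_univ]
  have h2 := hf.tendsto_rightLim_of_isOpen isOpen_univ h1
  rw [nhdsWithin_univ] at h1 h2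
  have hball := Metric.ball_mem_nhds (f t) (half_pos hε)
  obtain ⟨δ, hδ, hδf⟩ := Metric.eventually_nhds_iff.1 ((h1.eventually hball).and (h2.eventually hball))
  filter_upwards [h.eventually (gt_mem_nhds (lt_min hδ (half_pos hε)))] with i hi
  obtain ⟨p, q, hp, hq, hpq⟩ := exists_dist_lt_of_skorokhodM1Dist_lt hf (hg i) hab hi
  -- At the parameter s where q passes through (g i t, t), the point p s of the graph of f has a
  -- time near t, so its value lies on a segment inside a small ball around f t.
  obtain ⟨s, hs⟩ : (g i t, t) ∈ range q := hq.range_eq ▸ ⟨ht, left_mem_uIcc⟩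
  have hmem := (hp.mem s).2
  have hd := (ContinuousMap.dist_apply_le_dist s).trans_lt hpq
  rw [hs, Prod.dist_eq, max_lt_iff] at hd
  obtain ⟨h3, h4⟩ := hδf (hd.2.trans_le (min_le_left _ _))
  have h5 : (p s).1 ∈ Metric.ball (f t) (ε / 2) := by
    rw [← segment_eq_uIcc] at hmem
    exact (convex_ball (f t) (ε / 2)).segment_subset h3 h4 hmem
  calc dist (g i t) (f t) ≤ dist (p s).1 (g i t) + dist (p s).1 (f t) := dist_triangle_left _ _ _
    _ < ε / 2 + ε / 2 := add_lt_add (hd.1.trans_le (min_le_right _ _)) h5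
    _ = ε := add_halves ε

namespace SkorokhodSpace

open MeasureTheory

variable {H : Type*} [NormedAddCommGroup H] [InnerProductSpace ℝ H] {e : ℕ → H}

theorem tendsto_coord_of_continuousAt (Φ : SkorokhodSpace e) (k : ℕ) {t : ℝ} (ht : -1 ≤ t)
    (hc : ContinuousAt (Φ.coord k) t) :
    Tendsto (fun Ψ : SkorokhodSpace e => Ψ.coord k t) (𝓝 Φ) (𝓝 (Φ.coord k t)) := by
  obtain ⟨M, hM⟩ := exists_nat_gt t
  have hM' : t < ((M + 1 : ℕ) : ℝ) := by push_cast; linarith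
  have heq : ∀ Ψ : SkorokhodSpace e, ∀ s < ((M + 1 : ℕ) : ℝ),
      inner ℝ (Ψ.hat (M + 1) s) (e k) = Ψ.coord k s := fun Ψ s hs => by
    rw [inner_hat, min_eq_left hs.le]
  have h := tendsto_apply_of_tendsto_skorokhodM1Dist (t := t) (Φ.isCaglad_inner_hat (M + 1) k)
    (fun Ψ : SkorokhodSpace e => Ψ.isCaglad_inner_hat (M + 1) k)
    (neg_one_lt_cast_add_one (M + 1)) ⟨ht, by linarith⟩
    (hc.congr (by filter_upwards [Iio_mem_nhds hM'] with s hs using (heq Φ s hs).symm))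
    (tendsto_coordDist Φ M k)
  simpa only [heq _ t hM'] using h

/-- The bounded coordinate `arctan ⟨Φ t, e k⟩` of a path. -/
def bddCoord (Φ : SkorokhodSpace e) (k : ℕ) (t : ℝ) : ℝ := Real.arctan (Φ.coord k t)

theorem abs_bddCoord_le (Φ : SkorokhodSpace e) (k : ℕ) (t : ℝ) :
    |Φ.bddCoord k t| ≤ Real.pi / 2 :=
  abs_le.2 ⟨(Real.neg_pi_div_two_lt_arctan _).le, (Real.arctan_lt_pi_div_two _).le⟩

theorem aestronglyMeasurable_bddCoord (Φ : SkorokhodSpace e) (k : ℕ) :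
    AEStronglyMeasurable (Φ.bddCoord k) volume :=
  Real.continuous_arctan.comp_aestronglyMeasurable (Φ.isCaglad_coord k).aestronglyMeasurable

/-- The Laplace transform, at the positive integer `n + 1`, of a bounded coordinate of a path. -/
def laplace (n k : ℕ) (Φ : SkorokhodSpace e) : ℝ :=
  ∫ t in Ioi (0 : ℝ), Real.exp (-((n : ℝ) + 1) * t) * Φ.bddCoord k t

theorem integrableOn_exp_neg (n : ℕ) (c : ℝ) :
    IntegrableOn (fun t : ℝ => Real.exp (-((n : ℝ) + 1) * t)) (Ioi c) :=
  exp_neg_integrableOn_Ioi c (by positivity)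

theorem norm_exp_mul_bddCoord_le (n k : ℕ) (Φ : SkorokhodSpace e) (t : ℝ) :
    ‖Real.exp (-((n : ℝ) + 1) * t) * Φ.bddCoord k t‖ ≤
      Real.exp (-((n : ℝ) + 1) * t) * (Real.pi / 2) := by
  rw [norm_mul, Real.norm_of_nonneg (Real.exp_pos _).le]
  exact mul_le_mul_of_nonneg_left (Φ.abs_bddCoord_le k t) (Real.exp_pos _).le

theorem aestronglyMeasurable_exp_mul_bddCoord (n k : ℕ) (Φ : SkorokhodSpace e) :
    AEStronglyMeasurable (fun t => Real.exp (-((n : ℝ) + 1) * t) * Φ.bddCoord k t) volume :=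
  (Continuous.aestronglyMeasurable (by fun_prop)).mul (Φ.aestronglyMeasurable_bddCoord k)

theorem integrableOn_exp_mul_bddCoord (n k : ℕ) (Φ : SkorokhodSpace e) (c : ℝ) :
    IntegrableOn (fun t => Real.exp (-((n : ℝ) + 1) * t) * Φ.bddCoord k t) (Ioi c) :=
  Integrable.mono' ((integrableOn_exp_neg n c).mul_const _)
    (aestronglyMeasurable_exp_mul_bddCoord n k Φ).restrict
    (Eventually.of_forall (norm_exp_mul_bddCoord_le n k Φ))

/-- Evaluation at a fixed time need not be continuous, but it converges at every nonnegative time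
that is not a jump of the limit path. This is almost every time, and dominated convergence applies.
-/
theorem continuous_laplace (n k : ℕ) :
    Continuous (laplace n k : SkorokhodSpace e → ℝ) := by
  refine continuous_iff_continuousAt.2 fun Φ => ?_
  refine tendsto_integral_filter_of_dominated_convergence
    (fun t => Real.exp (-((n : ℝ) + 1) * t) * (Real.pi / 2))
    (Eventually.of_forall fun Ψ => (aestronglyMeasurable_exp_mul_bddCoord n k Ψ).restrict)
    (Eventually.of_forall fun Ψ => Eventually.of_forall (norm_exp_mul_bddCoord_le n k Ψ))
    ((integrableOn_exp_neg n 0).mul_const _) ?_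
  filter_upwards [ae_restrict_mem measurableSet_Ioi,
    ae_restrict_of_ae ((Φ.isCaglad_coord k).countable_jumps.ae_notMem volume)] with t ht hj
  exact ((Real.continuous_arctan.tendsto _).comp (Φ.tendsto_coord_of_continuousAt k
    ((neg_one_lt_zero.trans ht).le)
    ((Φ.isCaglad_coord k).continuousAt (not_not.1 hj)))).const_mul _

theorem coord_continuation_of_le {T : ℝ≥0} (Φ Ψ : SkorokhodSpace e) (k : ℕ) {t : ℝ} (ht : t ≤ T) :
    (continuation T Φ Ψ).coord k t = Φ.coord k t := by
  have : t.toNNReal ≤ T := Real.toNNReal_le_iff_le_coe.2 ht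
  simp [coord, continuation, this]

theorem coord_continuation_of_lt {T : ℝ≥0} (Φ Ψ : SkorokhodSpace e) (k : ℕ) {t : ℝ}
    (ht : (T : ℝ) < t) : (continuation T Φ Ψ).coord k t = Ψ.coord k (t - T) := by
  have h1 : ¬ t.toNNReal ≤ T := not_le.2 (Real.lt_toNNReal_iff_coe_lt.2 ht)
  have h2 : (t - T).toNNReal = t.toNNReal - T := by
    rw [NNReal.sub_def, Real.coe_toNNReal _ (T.2.trans ht.le)]
  simp [coord, continuation, h1, h2]

theorem setIntegral_Ioi_comp_sub (F : ℝ → ℝ) (T : ℝ) :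
    ∫ t in Ioi T, F (t - T) = ∫ t in Ioi 0, F t := by
  rw [← integral_indicator measurableSet_Ioi, ← integral_indicator measurableSet_Ioi,
    ← integral_sub_right_eq_self (indicator (Ioi 0) F) T]
  congr 1
  ext t
  simp [indicator]

/-- The effect of a continuation on the Laplace transforms. -/
theorem laplace_continuation (n k : ℕ) (T : ℝ≥0) (Φ Ψ : SkorokhodSpace e) :
    laplace n k (continuation T Φ Ψ) =
      (∫ t in Ioc (0 : ℝ) T, Real.exp (-((n : ℝ) + 1) * t) * Φ.bddCoord k t) +
        Real.exp (-((n : ℝ) + 1) * T) * laplace n k Ψ := by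
  have hint := integrableOn_exp_mul_bddCoord n k (continuation T Φ Ψ) 0
  rw [laplace, ← Ioc_union_Ioi_eq_Ioi T.2, setIntegral_union Ioc_disjoint_Ioi_same
    measurableSet_Ioi (hint.mono_set Ioc_subset_Ioi_self)
    (hint.mono_set (Ioi_subset_Ioi T.2))]
  congr 1
  · refine setIntegral_congr_fun measurableSet_Ioc fun t ht => ?_
    simp only [bddCoord, coord_continuation_of_le Φ Ψ k ht.2]
  · rw [laplace, ← integral_const_mul, ← setIntegral_Ioi_comp_sub _ (T : ℝ)]
    refine setIntegral_congr_fun measurableSet_Ioi fun t ht => ?_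
    simp only [bddCoord, coord_continuation_of_lt Φ Ψ k ht]
    rw [← mul_assoc, ← Real.exp_add]
    congr 2
    ring

theorem continuation_shift (T : ℝ≥0) (Φ : SkorokhodSpace e) :
    continuation T Φ (Φ.shift T) = Φ := by
  ext t
  by_cases h : t ≤ T
  · simp [continuation, h]
  · simp [continuation, shift, h, add_tsub_cancel_of_le (not_le.1 h).le]

end SkorokhodSpace

/-! ### Uniqueness for Laplace transforms at the positive integers -/

section LaplaceUniqueness

open MeasureTheory Polynomial

variable {g : ℝ → ℝ} {C : ℝ}

theorem integrableOn_exp_neg_mul_bounded (hm : AEStronglyMeasurable g volume)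
    (hC : ∀ t, |g t| ≤ C) (n : ℕ) :
    IntegrableOn (fun t => Real.exp (-((n : ℝ) + 1) * t) * g t) (Ioi 0) :=
  Integrable.mul_bdd (c := C) (SkorokhodSpace.integrableOn_exp_neg n 0) hm.restrict
    (Eventually.of_forall hC)

theorem exp_neg_mul_eval (p : ℝ[X]) (t : ℝ) :
    Real.exp (-t) * p.eval (Real.exp (-t)) * g t =
      ∑ i ∈ Finset.range (p.natDegree + 1),
        p.coeff i * (Real.exp (-((i : ℝ) + 1) * t) * g t) := by
  rw [eval_eq_sum_range, Finset.mul_sum, Finset.sum_mul]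
  refine Finset.sum_congr rfl fun i _ => ?_
  have : Real.exp (-((i : ℝ) + 1) * t) = Real.exp (-t) * Real.exp (-t) ^ i := by
    rw [← Real.exp_nat_mul, ← Real.exp_add]
    congr 1
    ring
  rw [this]
  ring

/-- A continuous compactly supported function on `(0, ∞)` becomes a continuous function on `[0, 1]`
in the variable `exp (-t)`. -/
theorem continuousOn_inv_mul_comp_neg_log {ψ : ℝ → ℝ} (hψ : Continuous ψ)
    (hs : HasCompactSupport ψ) : ContinuousOn (fun s => s⁻¹ * ψ (-Real.log s)) (Icc 0 1) := by
  rintro s -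
  refine ContinuousAt.continuousWithinAt ?_
  rcases eq_or_ne s 0 with rfl | h0
  · obtain ⟨K, hK⟩ := hs.isCompact.bddAbove
    -- Near 0, -log s exceeds every point of the support; at s = 0 itself the convention 0⁻¹ = 0
    -- gives the value.
    have hzero : ∀ᶠ s in 𝓝 (0 : ℝ), s⁻¹ * ψ (-Real.log s) = 0 := by
      have h1 := eventually_nhdsWithin_iff.1
        (Real.tendsto_log_nhdsNE_zero.eventually (eventually_lt_atBot (-K)))
      filter_upwards [h1] with s hs'
      rcases eq_or_ne s 0 with rfl | h
      · simp
      · have hmem : -Real.log s ∉ tsupport ψ := fun hmem => by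
          have := hK hmem
          have := hs' h
          linarith
        rw [image_eq_zero_of_notMem_tsupport hmem, mul_zero]
    exact (continuousAt_const (y := (0 : ℝ))).congr (hzero.mono fun _ h => h.symm)
  · have := Real.continuousAt_log h0
    exact (continuousAt_inv₀ h0).mul (hψ.continuousAt.comp this.neg)

/-- A bounded function on `(0, ∞)` is determined almost everywhere by its Laplace transform at the
positive integers. -/
theorem ae_eq_zero_of_laplace_eq_zero (hm : AEStronglyMeasurable g volume)
    (hC : ∀ t, |g t| ≤ C)
    (h : ∀ n : ℕ, ∫ t in Ioi (0 : ℝ), Real.exp (-((n : ℝ) + 1) * t) * g t = 0) :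
    ∀ᵐ t, t ∈ Ioi (0 : ℝ) → g t = 0 := by
  have hC0 : 0 ≤ C := (abs_nonneg _).trans (hC 0)
  have hloc : LocallyIntegrable g volume :=
    (memLp_top_of_bound hm C (Eventually.of_forall hC)).locallyIntegrable le_top
  have hexp : IntegrableOn (fun t : ℝ => Real.exp (-t)) (Ioi 0) := integrableOn_exp_neg_Ioi 0
  refine isOpen_Ioi.ae_eq_zero_of_integral_contDiff_smul_eq_zero
    (hloc.locallyIntegrableOn _) fun ψ hψ hψs hψt => ?_
  have hpoly : ∀ p : ℝ[X],
      IntegrableOn (fun t => Real.exp (-t) * p.eval (Real.exp (-t)) * g t) (Ioi 0) ∧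
      ∫ t in Ioi (0 : ℝ), Real.exp (-t) * p.eval (Real.exp (-t)) * g t = 0 := by
    intro p
    have hi : ∀ i ∈ Finset.range (p.natDegree + 1), Integrable
        (fun t => p.coeff i * (Real.exp (-((i : ℝ) + 1) * t) * g t))
        (volume.restrict (Ioi 0)) := fun i _ =>
      (integrableOn_exp_neg_mul_bounded hm hC i).const_mul _
    simp_rw [exp_neg_mul_eval]
    refine ⟨integrable_finsetSum _ hi, ?_⟩
    rw [integral_finsetSum _ hi]
    exact Finset.sum_eq_zero fun i _ => by rw [integral_const_mul, h, mul_zero]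
  have hψi : Integrable (fun t => ψ t * g t) volume :=
    (hψ.continuous.integrable_of_hasCompactSupport hψs).mul_bdd (c := C) hm (Eventually.of_forall hC)
  have hψ0 : ∫ t, ψ t • g t = ∫ t in Ioi (0 : ℝ), ψ t * g t := by
    simp only [smul_eq_mul]
    refine (setIntegral_eq_integral_of_forall_compl_eq_zero fun t ht => ?_).symm
    rw [image_eq_zero_of_notMem_tsupport fun h' => ht (hψt h'), zero_mul]
  rw [hψ0, ← norm_eq_zero]
  refine le_antisymm (le_of_forall_pos_le_add fun ε hε => ?_) (norm_nonneg _)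
  rw [zero_add]
  -- With s = exp(-t), the polynomial approximates s⁻¹ ψ(-log s). Hence exp(-t) p(exp(-t)), which
  -- integrates to 0 against g, approximates ψ with an error that carries the integrable factor
  -- exp(-t).
  obtain ⟨p, hp⟩ := exists_polynomial_near_of_continuousOn 0 1 _
    (continuousOn_inv_mul_comp_neg_log hψ.continuous hψs) (ε / (C + 1)) (by positivity)
  have h3 : ∫ t in Ioi (0 : ℝ), ψ t * g t =
      (∫ t in Ioi (0 : ℝ), ψ t * g t) -
        ∫ t in Ioi (0 : ℝ), Real.exp (-t) * p.eval (Real.exp (-t)) * g t := by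
    rw [(hpoly p).2, sub_zero]
  rw [h3, ← integral_sub hψi.integrableOn (hpoly p).1]
  have hb : ∀ᵐ t ∂volume.restrict (Ioi (0 : ℝ)),
      ‖ψ t * g t - Real.exp (-t) * p.eval (Real.exp (-t)) * g t‖ ≤ Real.exp (-t) * ε := by
    filter_upwards [ae_restrict_mem measurableSet_Ioi] with t ht
    have h1 := hp (Real.exp (-t)) ⟨(Real.exp_pos _).le, by
      rw [Real.exp_le_one_iff]; linarith [mem_Ioi.1 ht]⟩
    rw [Real.log_exp, neg_neg] at h1
    have h2 : ψ t * g t - Real.exp (-t) * p.eval (Real.exp (-t)) * g t =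
        -(Real.exp (-t) * ((p.eval (Real.exp (-t)) - (Real.exp (-t))⁻¹ * ψ t) * g t)) := by
      have := Real.exp_ne_zero (-t)
      field_simp
      ring
    rw [h2, norm_neg, norm_mul, norm_mul, Real.norm_of_nonneg (Real.exp_pos _).le]
    refine mul_le_mul_of_nonneg_left ?_ (Real.exp_pos _).le
    calc _ ≤ ε / (C + 1) * (C + 1) :=
          mul_le_mul h1.le ((hC t).trans (by linarith)) (abs_nonneg _) (by positivity)
      _ = ε := by field_simp
  refine (norm_integral_le_of_norm_le (hexp.mul_const ε) hb).trans_eq ?_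
  rw [integral_mul_const, integral_exp_neg_Ioi_zero, one_mul]

end LaplaceUniqueness

namespace SkorokhodSpace

open MeasureTheory

variable {H : Type*} [NormedAddCommGroup H] [InnerProductSpace ℝ H] {e : ℕ → H}

/-- Uniqueness gives equality almost everywhere. Left-continuity would turn a difference at t into
one on an interval to the left of t. -/
theorem coord_eq_of_laplace_eq {Φ Ψ : SkorokhodSpace e} {k : ℕ}
    (h : ∀ n, laplace n k Φ = laplace n k Ψ) {t : ℝ} (ht : 0 < t) :
    Φ.coord k t = Ψ.coord k t := by
  set g : ℝ → ℝ := fun t => Φ.bddCoord k t - Ψ.bddCoord k t with hg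
  have hae := ae_eq_zero_of_laplace_eq_zero (g := g) (C := Real.pi)
    ((Φ.aestronglyMeasurable_bddCoord k).sub (Ψ.aestronglyMeasurable_bddCoord k))
    (fun t => (abs_sub _ _).trans (by
      linarith [Φ.abs_bddCoord_le k t, Ψ.abs_bddCoord_le k t])) fun n => by
      simp only [hg, mul_sub]
      rw [integral_sub (integrableOn_exp_mul_bddCoord n k Φ 0)
        (integrableOn_exp_mul_bddCoord n k Ψ 0)]
      exact sub_eq_zero.2 (h n)
  have hgt : Tendsto g (𝓝[<] t) (𝓝 (g t)) :=
    ((Real.continuous_arctan.tendsto _).comp ((Φ.isCaglad_coord k).left_cont t)).sub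
      ((Real.continuous_arctan.tendsto _).comp ((Ψ.isCaglad_coord k).left_cont t))
  by_contra hne
  have hgne : g t ≠ 0 := fun h0 => hne (Real.arctan_injective (sub_eq_zero.1 h0))
  obtain ⟨c, hct, hc⟩ := mem_nhdsLT_iff_exists_Ioo_subset.1
    ((hgt.eventually (isOpen_ne.mem_nhds hgne)).and
      (mem_nhdsWithin_of_mem_nhds (Ioi_mem_nhds ht)))
  have hzero : volume (Ioo c t) = 0 :=
    measure_mono_null
    (fun s hs (h' : s ∈ Ioi (0 : ℝ) → g s = 0) => (hc hs).1 (h' (hc hs).2)) hae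
  rw [Real.volume_Ioo, ENNReal.ofReal_eq_zero] at hzero
  linarith [mem_Iio.1 hct]

/-- Paths with the same initial value and the same Laplace transforms are equal. -/
theorem eq_of_laplace_eq (he : Dense (Submodule.span ℝ (range e) : Set H))
    {Φ Ψ : SkorokhodSpace e} (h0 : Φ 0 = Ψ 0) (h : ∀ n k, laplace n k Φ = laplace n k Ψ) :
    Φ = Ψ := by
  ext t
  -- The transforms do not see the value at 0, from which the path may jump immediately; it needs
  -- its own hypothesis.
  rcases eq_or_lt_of_le (zero_le (a := t)) with rfl | ht
  · exact h0
  · refine he.eq_of_inner_left ℝ fun v hv => ?_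
    induction hv using Submodule.span_induction with
    | mem v hv =>
      obtain ⟨k, rfl⟩ := hv
      have := coord_eq_of_laplace_eq (fun n => h n k) (NNReal.coe_pos.2 ht)
      simpa [coord] using this
    | zero => simp
    | add v w _ _ hv hw => rw [inner_add_right, inner_add_right, hv, hw]
    | smul c v _ hv => rw [inner_smul_right, inner_smul_right, hv]

end SkorokhodSpace

/-! ### Measurable set-valued maps and maximization -/

section SetValuedMaps

variable {X Y : Type*}

/-- Closed-measurability of a set-valued map: for every closed `F`, the set of the points whose value
meets `F` is measurable. -/
def ClosedMeasurableSetMap [MeasurableSpace X] [TopologicalSpace Y] (W : X → Set Y) : Prop :=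
  ∀ F : Set Y, IsClosed F → MeasurableSet {x | (W x ∩ F).Nonempty}

/-- A compact set disjoint from a closed F stays away from some thickening of F, so meeting F
amounts to meeting each of countably many open thickenings. The closed version is the one that
passes to maximizers and to decreasing intersections. -/
theorem BorelMeasurableSetMap.closedMeasurable [MeasurableSpace X] [PseudoMetricSpace Y]
    {W : X → Set Y} (hW : BorelMeasurableSetMap W) (hc : ∀ x, IsCompact (W x)) :
    ClosedMeasurableSetMap W := by
  intro F hF
  have h : {x | (W x ∩ F).Nonempty} =
      ⋂ n : ℕ, {x | (W x ∩ Metric.thickening (1 / ((n : ℝ) + 1)) F).Nonempty} := by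
    ext x
    simp only [mem_ofPred_eq, mem_iInter]
    refine ⟨fun h n => h.mono (inter_subset_inter_right _
      (Metric.self_subset_thickening (by positivity) F)), fun h => ?_⟩
    by_contra hne
    obtain ⟨δ, hδ, hdisj⟩ := (disjoint_iff_inter_eq_empty.2
      (not_nonempty_iff_eq_empty.1 hne)).exists_thickenings (hc x) hF
    obtain ⟨n, hn⟩ := exists_nat_one_div_lt hδ
    obtain ⟨y, hyW, hyF⟩ := h n
    exact disjoint_left.1 hdisj (Metric.self_subset_thickening hδ _ hyW)
      (Metric.thickening_mono hn.le _ hyF)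
  rw [h]
  exact MeasurableSet.iInter fun n => hW _ Metric.isOpen_thickening

/-- The points of `W x` at which `ζ` is maximal. -/
def maximizers (ζ : Y → ℝ) (W : X → Set Y) (x : X) : Set Y :=
  {y ∈ W x | ∀ z ∈ W x, ζ z ≤ ζ y}

variable [TopologicalSpace Y] {ζ : Y → ℝ} {W : X → Set Y}

theorem isCompact_maximizers (hζ : Continuous ζ) {x : X} (hc : IsCompact (W x)) :
    IsCompact (maximizers ζ W x) := by
  have h : IsClosed {y | ∀ z ∈ W x, ζ z ≤ ζ y} := by
    simp only [ofPred_forall]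
    exact isClosed_biInter fun z _ => isClosed_le continuous_const hζ
  exact hc.inter_right h

theorem nonempty_maximizers (hζ : Continuous ζ) {x : X} (hc : IsCompact (W x))
    (hn : (W x).Nonempty) : (maximizers ζ W x).Nonempty := by
  obtain ⟨y, hy, hmax⟩ := hc.exists_isMaxOn hn hζ.continuousOn
  exact ⟨y, hy, hmax⟩

/-- F contains a maximizer exactly when W x meets F and every rational level reached by ζ on W x is
also reached on W x ∩ F. -/
theorem ClosedMeasurableSetMap.maximizers [MeasurableSpace X] (hW : ClosedMeasurableSetMap W)
    (hc : ∀ x, IsCompact (W x)) (hζ : Continuous ζ) :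
    ClosedMeasurableSetMap (maximizers ζ W) := by
  intro F hF
  have hcl : ∀ q : ℚ, IsClosed {y | (q : ℝ) ≤ ζ y} := fun q => isClosed_le continuous_const hζ
  have h : {x | (_root_.maximizers ζ W x ∩ F).Nonempty} =
      {x | (W x ∩ F).Nonempty} ∩ ⋂ q : ℚ, ({x | (W x ∩ (F ∩ {y | (q : ℝ) ≤ ζ y})).Nonempty} ∪
        {x | (W x ∩ {y | (q : ℝ) ≤ ζ y}).Nonempty}ᶜ) := by
    ext x
    simp only [mem_inter_iff, mem_iInter, mem_union, mem_compl_iff]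
    constructor
    · rintro ⟨y, ⟨hyW, hmax⟩, hyF⟩
      refine ⟨⟨y, hyW, hyF⟩, fun q => or_iff_not_imp_right.2 fun hq => ?_⟩
      obtain ⟨z, hzW, hz⟩ := not_not.1 hq
      exact ⟨y, hyW, hyF, le_trans hz (hmax z hzW)⟩
    · rintro ⟨hne, hq⟩
      obtain ⟨y, hy, hmax⟩ := ((hc x).inter_right hF).exists_isMaxOn hne hζ.continuousOn
      refine ⟨y, ⟨hy.1, fun z hz => ?_⟩, hy.2⟩
      by_contra! hlt
      obtain ⟨q, hq1, hq2⟩ := exists_rat_btwn hlt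
      rcases hq q with ⟨y', hy'W, hy'F, hy'⟩ | hnot
      · exact absurd (hmax (a := y') ⟨hy'W, hy'F⟩) (not_le.2 (hq1.trans_le hy'))
      · exact hnot ⟨z, hz, hq2.le⟩
  rw [h]
  exact (hW F hF).inter (MeasurableSet.iInter fun q =>
    (hW _ (hF.inter (hcl q))).union (hW _ (hcl q)).compl)

theorem nonempty_iInter_inter_iff [T2Space Y] {K : ℕ → Set Y} (hanti : ∀ n, K (n + 1) ⊆ K n)
    (hc : ∀ n, IsCompact (K n)) {F : Set Y} (hF : IsClosed F) :
    ((⋂ n, K n) ∩ F).Nonempty ↔ ∀ n, (K n ∩ F).Nonempty := by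
  refine ⟨fun h n => h.mono (inter_subset_inter_left _ (iInter_subset _ n)), fun h => ?_⟩
  rw [iInter_inter]
  exact IsCompact.nonempty_iInter_of_sequence_nonempty_isCompact_isClosed _
    (fun n => inter_subset_inter_left _ (hanti n)) h ((hc 0).inter_right hF)
    fun n => (hc n).isClosed.inter hF

theorem closedMeasurable_iInter [MeasurableSpace X] [T2Space Y] {W : ℕ → X → Set Y}
    (hW : ∀ n, ClosedMeasurableSetMap (W n)) (hanti : ∀ n x, W (n + 1) x ⊆ W n x)
    (hc : ∀ n x, IsCompact (W n x)) : ClosedMeasurableSetMap fun x => ⋂ n, W n x := by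
  intro F hF
  have h : {x | ((⋂ n, W n x) ∩ F).Nonempty} = ⋂ n, {x | (W n x ∩ F).Nonempty} := by
    ext x
    rw [mem_iInter]
    exact nonempty_iInter_inter_iff (fun n => hanti n x) (fun n => hc n x) hF
  rw [h]
  exact MeasurableSet.iInter fun n => hW n F hF

end SetValuedMaps

/-! ### Reduction to a single path -/

namespace SkorokhodSpace

variable {H : Type*} [NormedAddCommGroup H] [InnerProductSpace ℝ H] {e : ℕ → H}

/-- The initial value is read off at time -1: the extended coordinate is constant on negative times,
hence continuous there, whereas it may jump at 0. -/
theorem continuous_inner_apply_zero (k : ℕ) :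
    Continuous fun Φ : SkorokhodSpace e => inner ℝ (Φ 0) (e k) := by
  refine continuous_iff_continuousAt.2 fun Φ => ?_
  have hc : ContinuousAt (Φ.coord k) (-1) := by
    refine (continuousAt_const (y := inner ℝ (Φ 0) (e k))).congr ?_
    filter_upwards [Iio_mem_nhds (neg_one_lt_zero (R := ℝ))] with s hs
    rw [coord, Real.toNNReal_of_nonpos (le_of_lt hs)]
  have h := Φ.tendsto_coord_of_continuousAt k le_rfl hc
  simp only [coord, Real.toNNReal_of_nonpos (neg_one_lt_zero (R := ℝ)).le] at h
  exact h

theorem t2Space (he : Dense (Submodule.span ℝ (range e) : Set H)) :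
    T2Space (SkorokhodSpace e) := by
  refine T2Space.of_injective_continuous
    (f := fun Φ : SkorokhodSpace e => ((fun k => inner ℝ (Φ 0) (e k),
      fun n k => laplace n k Φ) : (ℕ → ℝ) × (ℕ → ℕ → ℝ))) (fun Φ Ψ h => ?_) ?_
  · obtain ⟨h1, h2⟩ := Prod.mk.inj h
    refine eq_of_laplace_eq he (he.eq_of_inner_left ℝ fun v hv => ?_)
      fun n k => congrFun (congrFun h2 n) k
    induction hv using Submodule.span_induction with
    | mem v hv =>
      obtain ⟨k, rfl⟩ := hv
      exact congrFun h1 k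
    | zero => simp
    | add v w _ _ hv hw => rw [inner_add_right, inner_add_right, hv, hw]
    | smul c v _ hv => rw [inner_smul_right, inner_smul_right, hv]
  · exact (continuous_pi fun k => continuous_inner_apply_zero k).prodMk
      (continuous_pi fun n => continuous_pi fun k => continuous_laplace n k)

variable {D : Set H}

/-- Shift invariance of a family of sets of paths. -/
def ShiftInvariant (W : D → Set (SkorokhodSpace e)) : Prop :=
  ∀ T : ℝ≥0, 0 < T → ∀ x : D, ∀ Φ ∈ W x, ∃ h : Φ T ∈ D, Φ.shift T ∈ W ⟨Φ T, h⟩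

/-- Stability of a family of sets of paths under continuation. -/
def ContinuationInvariant (W : D → Set (SkorokhodSpace e)) : Prop :=
  ∀ T : ℝ≥0, 0 < T → ∀ x : D, ∀ Φ₁ ∈ W x, ∀ h : Φ₁ T ∈ D, ∀ Φ₂ ∈ W ⟨Φ₁ T, h⟩,
    continuation T Φ₁ Φ₂ ∈ W x

variable {W : D → Set (SkorokhodSpace e)}

theorem laplace_eq_shift (n k : ℕ) (T : ℝ≥0) (Φ : SkorokhodSpace e) :
    laplace n k Φ =
      (∫ t in Ioc (0 : ℝ) T, Real.exp (-((n : ℝ) + 1) * t) * Φ.bddCoord k t) +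
        Real.exp (-((n : ℝ) + 1) * T) * laplace n k (Φ.shift T) := by
  rw [← laplace_continuation, continuation_shift]

/-- If some Ψ started at Φ T had a larger functional than the tail of Φ, splicing it onto Φ at T
would beat Φ. -/
theorem ShiftInvariant.maximizers (hs : ShiftInvariant W) (hc : ContinuationInvariant W)
    (n k : ℕ) : ShiftInvariant (maximizers (laplace n k) W) := by
  rintro T hT x Φ ⟨hΦ, hmax⟩
  obtain ⟨h, hsh⟩ := hs T hT x Φ hΦ
  refine ⟨h, hsh, fun Ψ hΨ => ?_⟩
  have h1 := hmax _ (hc T hT x Φ hΦ h Ψ hΨ)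
  rw [laplace_continuation, laplace_eq_shift n k T Φ, add_le_add_iff_left] at h1
  exact le_of_mul_le_mul_left h1 (Real.exp_pos _)

/-- The tail of Φ₁ competes with Φ₂, so replacing it by Φ₂ does not lower the functional. -/
theorem ContinuationInvariant.maximizers (hs : ShiftInvariant W) (hc : ContinuationInvariant W)
    (n k : ℕ) : ContinuationInvariant (maximizers (laplace n k) W) := by
  rintro T hT x Φ₁ ⟨hΦ₁, hmax₁⟩ h Φ₂ ⟨hΦ₂, hmax₂⟩
  refine ⟨hc T hT x Φ₁ hΦ₁ h Φ₂ hΦ₂, fun Ψ hΨ => (hmax₁ Ψ hΨ).trans ?_⟩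
  obtain ⟨h', hsh⟩ := hs T hT x Φ₁ hΦ₁
  rw [laplace_continuation, laplace_eq_shift n k T Φ₁, add_le_add_iff_left]
  exact mul_le_mul_of_nonneg_left (hmax₂ _ hsh) (Real.exp_pos _).le

/-- The successive reductions of a family of sets of paths: all the functionals `laplace n k` are
maximized one after the other. -/
def reduction (U : D → Set (SkorokhodSpace e)) : ℕ → D → Set (SkorokhodSpace e)
  | 0 => U
  | i + 1 => maximizers (laplace i.unpair.1 i.unpair.2) (reduction U i)

variable {U : D → Set (SkorokhodSpace e)}

theorem reduction_succ_subset (i : ℕ) (x : D) : reduction U (i + 1) x ⊆ reduction U i x :=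
  fun _ h => h.1

theorem isCompact_reduction (hU : ∀ x, IsCompact (U x)) (i : ℕ) (x : D) :
    IsCompact (reduction U i x) := by
  induction i with
  | zero => exact hU x
  | succ i ih => exact isCompact_maximizers (continuous_laplace _ _) ih

theorem nonempty_reduction (hU : ∀ x, IsCompact (U x)) (hn : ∀ x, (U x).Nonempty) (i : ℕ)
    (x : D) : (reduction U i x).Nonempty := by
  induction i with
  | zero => exact hn x
  | succ i ih =>
    exact nonempty_maximizers (continuous_laplace _ _) (isCompact_reduction hU i x) ih

theorem closedMeasurable_reduction [MeasurableSpace H] (hU : ∀ x, IsCompact (U x))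
    (hm : ClosedMeasurableSetMap U) (i : ℕ) : ClosedMeasurableSetMap (reduction U i) := by
  induction i with
  | zero => exact hm
  | succ i ih => exact ih.maximizers (isCompact_reduction hU i) (continuous_laplace _ _)

theorem shift_continuation_reduction (hs : ShiftInvariant U) (hc : ContinuationInvariant U)
    (i : ℕ) : ShiftInvariant (reduction U i) ∧ ContinuationInvariant (reduction U i) := by
  induction i with
  | zero => exact ⟨hs, hc⟩
  | succ i ih => exact ⟨ih.1.maximizers ih.2 _ _, ih.2.maximizers ih.1 _ _⟩

theorem shiftInvariant_iInter_reduction (hs : ShiftInvariant U) (hc : ContinuationInvariant U) :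
    ShiftInvariant fun x => ⋂ i, reduction U i x := by
  intro T hT x Φ hΦ
  rw [mem_iInter] at hΦ
  obtain ⟨h, -⟩ := hs T hT x Φ (hΦ 0)
  exact ⟨h, mem_iInter.2 fun i =>
    ((shift_continuation_reduction hs hc i).1 T hT x Φ (hΦ i)).2⟩

/-- Two surviving paths both maximize `laplace n k` at stage `Nat.pair n k + 1`, over a set
containing both, so all their transforms agree. -/
theorem subsingleton_iInter_reduction (he : Dense (Submodule.span ℝ (range e) : Set H))
    (h0 : ∀ x : D, ∀ Φ ∈ U x, Φ 0 = (x : H)) (x : D) :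
    (⋂ i, reduction U i x).Subsingleton := by
  intro Φ hΦ Ψ hΨ
  rw [mem_iInter] at hΦ hΨ
  refine eq_of_laplace_eq he ((h0 x Φ (hΦ 0)).trans (h0 x Ψ (hΨ 0)).symm) fun n k => ?_
  have h1 := (hΦ (Nat.pair n k + 1)).2 Ψ (hΨ _)
  have h2 := (hΨ (Nat.pair n k + 1)).2 Φ (hΦ _)
  rw [Nat.unpair_pair] at h1 h2
  exact le_antisymm h2 h1

end SkorokhodSpace

end

theorem theorem3p1 {H : Type*} [NormedAddCommGroup H] [InnerProductSpace ℝ H] [CompleteSpace H]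
    [MeasurableSpace H] [BorelSpace H]
    (e : ℕ → H) (he : Dense (Submodule.span ℝ (Set.range e) : Set H))
    (D : Set H) (hDclosed : IsClosed D) (hDconvex : Convex ℝ D)
    (U : D → Set (SkorokhodSpace e))
    (hU_init : ∀ x : D, ∀ Φ ∈ U x, Φ 0 = (x : H))
    (hU_nonempty : ∀ x : D, (U x).Nonempty)
    (hU_compact : ∀ x : D, IsCompact (U x))
    (hU_measurable : BorelMeasurableSetMap U)
    (hU_shift : ∀ T : ℝ≥0, 0 < T → ∀ x : D, ∀ Φ ∈ U x,
      ∃ h : Φ T ∈ D, Φ.shift T ∈ U ⟨Φ T, h⟩)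
    (hU_continuation : ∀ T : ℝ≥0, 0 < T → ∀ x : D, ∀ Φ₁ ∈ U x, ∀ h : Φ₁ T ∈ D,
      ∀ Φ₂ ∈ U ⟨Φ₁ T, h⟩, SkorokhodSpace.continuation T Φ₁ Φ₂ ∈ U x) :
    ∃ u : D → SkorokhodSpace e, Measurable u ∧ (∀ x : D, u x ∈ U x) ∧
      ∀ x : D, ∀ t₁ : ℝ≥0, ∃ h : u x t₁ ∈ D, ∀ t₂ : ℝ≥0,
        u x (t₁ + t₂) = u ⟨u x t₁, h⟩ t₂ := by
  have : T2Space (SkorokhodSpace e) := SkorokhodSpace.t2Space he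
  have hshift := SkorokhodSpace.shiftInvariant_iInter_reduction hU_shift hU_continuation
  have hsub := SkorokhodSpace.subsingleton_iInter_reduction he hU_init
  have hne : ∀ x, (⋂ i, SkorokhodSpace.reduction U i x).Nonempty := fun x => by
    have h := (nonempty_iInter_inter_iff (F := univ)
      (fun n => SkorokhodSpace.reduction_succ_subset (U := U) n x)
      (fun n => SkorokhodSpace.isCompact_reduction hU_compact n x) isClosed_univ).2 fun n => by
        rw [inter_univ]
        exact SkorokhodSpace.nonempty_reduction hU_compact hU_nonempty n x
    rwa [inter_univ] at h
  choose u hu using hne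
  have hmeas := closedMeasurable_iInter
    (SkorokhodSpace.closedMeasurable_reduction hU_compact
      (hU_measurable.closedMeasurable hU_compact))
    SkorokhodSpace.reduction_succ_subset (SkorokhodSpace.isCompact_reduction hU_compact)
  have huU : ∀ x, u x ∈ U x := fun x => mem_iInter.1 (hu x) 0
  refine ⟨u, measurable_of_isClosed fun F hF => ?_, huU, fun x t₁ => ?_⟩
  -- The intersection is the singleton of u x, so it meets F exactly when u x ∈ F.
  · convert hmeas F hF using 1
    ext x
    refine ⟨fun h => ⟨u x, hu x, h⟩, ?_⟩
    rintro ⟨Φ, hΦ, hΦF⟩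
    rw [mem_preimage, hsub x (hu x) hΦ]
    exact hΦF
  -- Shift invariance is assumed only for positive times; time 0 is settled by the initial
  -- condition.
  · rcases eq_or_lt_of_le (zero_le (a := t₁)) with rfl | ht
    · have h0 : u x 0 = (x : H) := hU_init x _ (huU x)
      have hx : (⟨u x 0, h0 ▸ x.2⟩ : D) = x := Subtype.ext h0
      exact ⟨h0 ▸ x.2, fun t₂ => by rw [hx, zero_add]⟩
    · obtain ⟨h, hmem⟩ := hshift t₁ ht x (u x) (hu x)
      exact ⟨h, fun t₂ => congrArg (fun Φ : SkorokhodSpace e => Φ t₂)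
        (hsub _ hmem (hu ⟨u x t₁, h⟩))⟩
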